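/- **Generalization bound for bounded $\rho$-norm functions.** There is an absolute constant $C'>0$, and for every dimension $d\ge 1$ there is a constant $C>0$ depending only on $d$, such that the following holds. Let $\gamma,\sigma,\epsilon>0$, $\nu\ge 0$, $0<\delta<1$, and let $s\ge 1$ and $m,N$ be integers with 1. $\displaystyle \gamma^2\sigma^2\ \ge\ \frac12\left(\Big(\frac{\sqrt{41}\,(2s-1)}{2}\Big)^{2/d}-1\right)$, 2. $\displaystyle N=\frac{4}{\epsilon^2}\left(1+4\gamma\sigma d\sqrt{1+\sqrt{\tfrac{12}{d}\log\tfrac{m}{\delta}}}+\sqrt{\tfrac12\log\tfrac1\delta}\right)^2$, 3. $\displaystyle m\ \ge\ 4(2\gamma^2\sigma^2+1)^d\log\frac{N^2}{\delta}$. Let $\phi(x;\omega)=\exp(i\langle x,\omega\rangle)$ for $x,\omega\in\mathbb R^d$, let $\rho$ be the density of $\mathcal N(0,\sigma^2I_d)$, and let $\mu=\mathcal N(0,\gamma^2I_d)$. Let $f\in\mathcal F(\phi,\rho)$, that is, $f(x)=\int_{\mathbb R^d}\alpha(\omega)\phi(x;\omega)\,d\omega$ for all $x$, with $\|f\|_\rho:=\sup_\omega|\alpha(\omega)/\rho(\omega)|<\infty$.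 Let $x_1,\dots,x_m\sim\mu$ and $\omega_1,\dots,\omega_N\sim\mathcal N(0,\sigma^2I_d)$ be jointly independent, and let $y_k=f(x_k)+e_k$, where the noise either satisfies $|e_k|\le 2\nu$ almost surely for all $k$, or consists of i.i.d. $\mathcal N(0,\nu^2)$ variables. Put $A=(\phi(x_k;\omega_j))_{k,j}\in\mathbb C^{m\times N}$, $\eta=\sqrt{2(\epsilon^2\|f\|_\rho^2+4\nu^2)}$ and $$c^\star=\frac1N\Big[\frac{\alpha(\omega_1)}{\rho(\omega_1)},\dots,\frac{\alpha(\omega_N)}{\rho(\omega_N)}\Big]^T .$$ Then with probability at least $1-5\delta$ the basis pursuit problem $\min\|c\|_1$ subject to $\|Ac-y\|_2\le\eta\sqrt m$ has a solution, and for every solution $c^\sharp$ and every index set $\mathcal S^\sharp$ of the $s$ largest (in magnitude) entries of $c^\sharp$ (all entries if $s\ge N$), the function $f^\sharp(x)=\sum_{j\in\mathcal S^\sharp}c^\sharp_j\,\phi(x;\omega_j)$ satisfies $$\sqrt{\int_{\mathbb R^d}|f-f^\sharp|^2\,d\mu}\ \le\ C'\Big(1+N^{\frac12}s^{-\frac12}m^{-\frac14}\log^{\frac14}\tfrac1\delta\Big)\kappa_{s,1}(c^\star)+C\Big(1+N^{\frac12}m^{-\frac14}\log^{\frac14}\tfrac1\delta\Big)\sqrt{\epsilon^2\|f\|_\rho^2+4\nu^2},$$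 where $\kappa_{s,1}(c)=\min\{\|c-z\|_1: z \text{ has at most } s \text{ nonzero entries}\}$. -/

import Mathlib

open MeasureTheory ProbabilityTheory

noncomputable section

namespace SRFE

/-- The density of the spherical Gaussian `N(0, σ² I_d)` on `ℝ^d`. -/
def gaussianDensity (d : ℕ) (σ : ℝ) (ω : EuclideanSpace ℝ (Fin d)) : ℝ :=
  (2 * Real.pi * σ ^ 2) ^ (-((d : ℝ) / 2)) * Real.exp (-(‖ω‖ ^ 2 / (2 * σ ^ 2)))

/-- The spherical Gaussian measure `N(0, σ² I_d)` on `ℝ^d`. -/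
def sphericalGaussian (d : ℕ) (σ : ℝ) : Measure (EuclideanSpace ℝ (Fin d)) :=
  volume.withDensity fun ω => ENNReal.ofReal (gaussianDensity d σ ω)

/-- The random Fourier feature `φ(x; ω) = exp(i ⟨x, ω⟩)`. -/
def fourierFeature {d : ℕ} (x ω : EuclideanSpace ℝ (Fin d)) : ℂ :=
  Complex.exp (Complex.I * ((inner ℝ x ω : ℝ) : ℂ))

/-- `f` belongs to the class `F(φ, ρ)` through the function `α`: for every `x` one has
`f x = ∫ α(ω) φ(x; ω) dω`, and `sup_ω |α(ω) / ρ(ω)| < ∞`. -/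
structure IsRepresentedBy {d : ℕ}
    (φ : EuclideanSpace ℝ (Fin d) → EuclideanSpace ℝ (Fin d) → ℂ)
    (ρ : EuclideanSpace ℝ (Fin d) → ℝ)
    (f α : EuclideanSpace ℝ (Fin d) → ℂ) : Prop where
  aestronglyMeasurable : AEStronglyMeasurable α volume
  eq_integral : ∀ x, f x = ∫ ω, α ω * φ x ω
  bddAbove : BddAbove (Set.range fun ω => ‖α ω / (ρ ω : ℂ)‖)

/-- The `ρ`-norm `sup_ω |α(ω) / ρ(ω)|` of the function represented by `α`. -/
def rhoNorm {d : ℕ} (ρ : EuclideanSpace ℝ (Fin d) → ℝ)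
    (α : EuclideanSpace ℝ (Fin d) → ℂ) : ℝ :=
  ⨆ ω, ‖α ω / (ρ ω : ℂ)‖

/-- The `ℓ¹` norm on `ℂ^n`. -/
def l1Norm {n : ℕ} (c : Fin n → ℂ) : ℝ := ∑ j, ‖c j‖

/-- The Euclidean norm on `ℂ^n`. -/
def l2Norm {n : ℕ} (c : Fin n → ℂ) : ℝ := Real.sqrt (∑ j, ‖c j‖ ^ 2)

/-- A vector is `s`-sparse if it has at most `s` nonzero entries. -/
def IsSparse {n : ℕ} (s : ℕ) (z : Fin n → ℂ) : Prop := (Function.support z).ncard ≤ s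

/-- The `ℓ¹` error of best `s`-term approximation, `κ_{s,1}(c)`. -/
def kappaOne {n : ℕ} (s : ℕ) (c : Fin n → ℂ) : ℝ :=
  sInf {r : ℝ | ∃ z : Fin n → ℂ, IsSparse s z ∧ r = l1Norm (c - z)}

/-- The random feature matrix `a_{k,j} = φ(x_k; ω_j)`. -/
def featureMatrix {d m N : ℕ} (x : Fin m → EuclideanSpace ℝ (Fin d))
    (w : Fin N → EuclideanSpace ℝ (Fin d)) : Matrix (Fin m) (Fin N) ℂ :=
  Matrix.of fun k j => fourierFeature (x k) (w j)

/-- `c` solves the basis pursuit problem: it minimizes `‖c‖₁` subject to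
`‖A c - y‖₂ ≤ η √m`. -/
def IsBasisPursuitSolution {m N : ℕ} (A : Matrix (Fin m) (Fin N) ℂ) (y : Fin m → ℂ) (η : ℝ)
    (c : Fin N → ℂ) : Prop :=
  l2Norm (A.mulVec c - y) ≤ η * Real.sqrt m ∧
    ∀ c' : Fin N → ℂ, l2Norm (A.mulVec c' - y) ≤ η * Real.sqrt m → l1Norm c ≤ l1Norm c'

/-- `S` is an index set of the `s` entries of `c` that are largest in magnitude (all entries if
there are at most `s` of them; ties are broken arbitrarily). -/
def IsLargestIndexSet {N : ℕ} (s : ℕ) (c : Fin N → ℂ) (S : Finset (Fin N)) : Prop :=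
  S.card = min s N ∧ ∀ j ∈ S, ∀ l, l ∉ S → ‖c l‖ ≤ ‖c j‖

/-- The pruned expansion `x ↦ ∑_{j ∈ S} c_j φ(x; ω_j)`. -/
def prunedExpansion {d N : ℕ} (w : Fin N → EuclideanSpace ℝ (Fin d)) (c : Fin N → ℂ)
    (S : Finset (Fin N)) (x : EuclideanSpace ℝ (Fin d)) : ℂ :=
  ∑ j ∈ S, c j * fourierFeature x (w j)

/-- The vector `c⋆_j = α(ω_j) / (N ρ(ω_j))`. -/
def cStar {d N : ℕ} (ρ : EuclideanSpace ℝ (Fin d) → ℝ) (α : EuclideanSpace ℝ (Fin d) → ℂ)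
    (w : Fin N → EuclideanSpace ℝ (Fin d)) (j : Fin N) : ℂ :=
  (1 / (N : ℂ)) * (α (w j) / (ρ (w j) : ℂ))

/-- The `L²(μ)` distance `(∫ |f - g|² dμ)^{1/2}`. -/
def l2Error {d : ℕ} (μ : Measure (EuclideanSpace ℝ (Fin d)))
    (f g : EuclideanSpace ℝ (Fin d) → ℂ) : ℝ :=
  Real.sqrt (∫ x, ‖f x - g x‖ ^ 2 ∂μ)

/-- The noise `e_1, …, e_m` is bounded by `E`. -/
def IsBoundedNoise {Ω : Type*} [MeasurableSpace Ω] (P : Measure Ω) {m : ℕ}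
    (E : ℝ) (e : Fin m → Ω → ℂ) : Prop :=
  ∀ᵐ τ ∂P, ∀ k, ‖e k τ‖ ≤ E

/-- The noise `e_1, …, e_m` is real, with independent entries of law `N(0, ν²)`. -/
def IsGaussianNoise {Ω : Type*} [MeasurableSpace Ω] (P : Measure Ω) {m : ℕ}
    (ν : ℝ) (e : Fin m → Ω → ℂ) : Prop :=
  ∃ g : Fin m → Ω → ℝ, (∀ k τ, e k τ = (g k τ : ℂ)) ∧
    (∀ k, HasLaw (g k) (gaussianReal 0 (Real.toNNReal (ν ^ 2))) P) ∧ iIndepFun g P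

end SRFE

end

/-! The vector `c⋆` is a Monte Carlo discretization of the integral for `f`, so its expansion `f⋆`
approximates `f` at the sample points and in `L²(μ)`. Both errors are at most `ε‖f‖_ρ` with high
probability, by McDiarmid's inequality applied to the `L²` norm of an empirical mean
(`measure_empiricalMean_ge_le`). Hence `c⋆` is feasible for basis pursuit, and every solution `c`
satisfies `‖c‖₁ ≤ ‖c⋆‖₁ ≤ κ + min(s, N) b` with `b = ‖f‖_ρ / N` and `κ = κ_{s,1}(c⋆)`.

No sparse recovery property of the feature matrix is needed: the `ℓ¹` bound and two properties of
Gaussian features suffice. First, the empirical characteristic function of the samples is within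
`1/(2s)` of the true one at all differences `ω_j - ω_l`. Population and empirical energies of an
expansion then differ by at most `‖·‖₁² / (2s)` (`integral_norm_sq_prunedExpansion_le`), which turns
the small residual of `c⋆ - c` on the samples into a small `L²(μ)` norm. Second, the row sums of the
Gaussian Gram matrix are controlled. The coefficients removed by pruning have `ℓ¹` norm at most `κ +
s b` and sup norm at most `1/s` times that, so a Schur bound makes their expansion small
(`sqrt_integral_norm_sq_spread_le`).

`l2Error_prunedExpansion_le` combines these facts deterministically, `exists_good_event` supplies
them outside five events of probability at most `δ` each, and the conditions on the bandwidth, `N`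
and `m` convert the outcome into a multiple of `κ` plus a multiple of `√(ε²‖f‖_ρ² + 4ν²)`. The
estimate obtained has no `m^(-1/4)` terms; the corresponding factors in the theorem enter only
through being at least `1`. -/

namespace SRFE

/-! ### McDiarmid's inequality -/

section BoundedDifferences

variable {W : Type*} [MeasurableSpace W]

lemma integrable_of_abs_le {X : Type*} [MeasurableSpace X] {μ : Measure X} [IsFiniteMeasure μ]
    {F : X → ℝ} (hF : Measurable F) {B : ℝ} (hB : ∀ x, |F x| ≤ B) : Integrable F μ :=
  Integrable.of_bound hF.aestronglyMeasurable B (ae_of_all _ fun x => by simpa using hB x)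

lemma abs_integral_le_of_abs_le {X : Type*} [MeasurableSpace X] {μ : Measure X}
    [IsProbabilityMeasure μ] {F : X → ℝ} {B : ℝ} (hB : ∀ x, |F x| ≤ B) : |∫ x, F x ∂μ| ≤ B := by
  simpa using norm_integral_le_of_norm_le_const (μ := μ) (f := F) (ae_of_all _ hB)

/-- Hoeffding's lemma for a function of oscillation at most `c`. -/
lemma integral_exp_sub_integral_le {ρ : Measure W} [IsProbabilityMeasure ρ] {h : W → ℝ}
    (hh : Measurable h) {c : ℝ} (hc : ∀ a b, |h a - h b| ≤ c) (t : ℝ) :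
    ∫ a, Real.exp (t * (h a - ∫ b, h b ∂ρ)) ∂ρ ≤ Real.exp (t ^ 2 * c ^ 2 / 8) := by
  have hne : Nonempty W := nonempty_of_isProbabilityMeasure ρ
  obtain ⟨a₀⟩ := hne
  have hbdd : BddBelow (Set.range h) := by
    refine ⟨h a₀ - c, ?_⟩
    rintro _ ⟨a, rfl⟩
    linarith [(abs_le.1 (hc a₀ a)).2]
  have hmem : ∀ a, h a ∈ Set.Icc (⨅ b, h b) ((⨅ b, h b) + c) := by
    have : Nonempty W := ⟨a₀⟩
    refine fun a => ⟨ciInf_le hbdd a, ?_⟩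
    have : h a - c ≤ ⨅ b, h b := le_ciInf fun b => by linarith [(abs_le.1 (hc a b)).2]
    linarith
  have hsub := (hasSubgaussianMGF_of_mem_Icc (μ := ρ) hh.aemeasurable (ae_of_all _ hmem)).mgf_le t
  refine hsub.trans (le_of_eq ?_)
  congr 1
  have : ((‖(⨅ b, h b) + c - ⨅ b, h b‖₊ : NNReal) : ℝ) = |c| := by
    rw [add_sub_cancel_left]; rfl
  simp only [NNReal.coe_pow, NNReal.coe_div, this, NNReal.coe_ofNat, div_pow, sq_abs]
  ring

/-- The exponential moment bound behind McDiarmid's inequality. -/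
theorem integral_exp_boundedDifferences (ρ : Measure W) [IsProbabilityMeasure ρ] {c : ℝ} (t : ℝ) :
    ∀ (n : ℕ) (F : (Fin n → W) → ℝ), Measurable F → (∃ B, ∀ w, |F w| ≤ B) →
      (∀ w j a, |F (Function.update w j a) - F w| ≤ c) →
      ∫ w, Real.exp (t * (F w - ∫ w', F w' ∂(Measure.pi fun _ => ρ))) ∂(Measure.pi fun _ => ρ) ≤
        Real.exp (n * (t ^ 2 * c ^ 2 / 8)) := by
  intro n
  induction n with
  | zero =>
    intro F _ _ _
    have h : ∀ w, F w = F (fun i => i.elim0) := fun w => congrArg F (Subsingleton.elim _ _)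
    simp [h]
  | succ n ih =>
    intro F hF ⟨B, hB⟩ hc
    set π : Measure (Fin n → W) := Measure.pi fun _ => ρ with hπ
    have hcons : Measurable fun p : W × (Fin n → W) => (Fin.cons p.1 p.2 : Fin (n + 1) → W) := by
      refine measurable_pi_lambda _ fun i => ?_
      refine Fin.cases ?_ (fun j => ?_) i
      · simpa using measurable_fst
      · have : Measurable fun p : W × (Fin n → W) => p.2 j := by fun_prop
        simpa using this
    have key : ∀ G : (Fin (n + 1) → W) → ℝ, ∫ w, G w ∂(Measure.pi fun _ => ρ) =
        ∫ p, G (Fin.cons p.1 p.2) ∂(ρ.prod π) := by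
      intro G
      have := ((measurePreserving_piFinSuccAbove (fun _ : Fin (n + 1) => ρ) 0).symm).integral_comp' G
      rw [← this]
      refine integral_congr_ae (ae_of_all _ fun p => congrArg G ?_)
      exact Fin.insertNth_zero' p.1 p.2
    set H : W → (Fin n → W) → ℝ := fun a w => F (Fin.cons a w) with hH
    have hHm : Measurable (Function.uncurry H) := hF.comp hcons
    have hH1 : ∀ w, Measurable fun a => H a w := fun w => hHm.comp measurable_prodMk_right
    set g : (Fin n → W) → ℝ := fun w => ∫ a, H a w ∂ρ with hg
    have hgm : Measurable g :=
      (StronglyMeasurable.integral_prod_left (μ := ρ) hHm.stronglyMeasurable).measurable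
    have hgB : ∀ w, |g w| ≤ B := fun w => abs_integral_le_of_abs_le fun a => hB _
    have hHi : ∀ w, Integrable (fun a => H a w) ρ := fun w =>
      integrable_of_abs_le (hH1 w) fun a => hB _
    -- Averaging out the first coordinate preserves bounded differences in the others, which is what
    -- lets the induction continue with `g`.
    have hgc : ∀ w j a, |g (Function.update w j a) - g w| ≤ c := by
      intro w j a
      rw [hg, ← integral_sub (hHi _) (hHi _)]
      refine abs_integral_le_of_abs_le fun b => ?_
      simp only [hH, Fin.cons_update]
      exact hc _ _ _
    have hmean : ∫ w, F w ∂(Measure.pi fun _ => ρ) = ∫ w, g w ∂π := by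
      rw [key, integral_prod_symm]
      exact integrable_of_abs_le (hF.comp hcons) fun _ => hB _
    have hB0 : 0 ≤ B := (abs_nonneg _).trans (hB (fun _ => (nonempty_of_isProbabilityMeasure ρ).some))
    set m := ∫ w, g w ∂π with hm
    have hmB : |m| ≤ B := abs_integral_le_of_abs_le hgB
    have hbound : ∀ y : ℝ, |y| ≤ B → |Real.exp (t * (y - m))| ≤ Real.exp (|t| * (2 * B)) := by
      intro y hy
      rw [abs_of_pos (Real.exp_pos _)]
      refine Real.exp_le_exp.2 ((le_abs_self _).trans ?_)
      rw [abs_mul]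
      refine mul_le_mul_of_nonneg_left ?_ (abs_nonneg _)
      calc |y - m| ≤ |y| + |m| := abs_sub _ _
        _ ≤ 2 * B := by linarith
    -- With the other coordinates frozen, the first one moves `F` by at most `c`, so Hoeffding's
    -- lemma pays one factor and leaves the moment of `g`.
    have hinner : ∀ w, ∫ a, Real.exp (t * (H a w - m)) ∂ρ ≤
        Real.exp (t ^ 2 * c ^ 2 / 8) * Real.exp (t * (g w - m)) := by
      intro w
      have h1 : ∀ a, Real.exp (t * (H a w - m)) =
          Real.exp (t * (H a w - g w)) * Real.exp (t * (g w - m)) := by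
        intro a; rw [← Real.exp_add]; ring_nf
      simp_rw [h1]
      rw [integral_mul_const]
      refine mul_le_mul_of_nonneg_right ?_ (Real.exp_pos _).le
      refine integral_exp_sub_integral_le (hH1 w) (fun a b => ?_) t
      have := hc (Fin.cons b w) 0 a
      rwa [Fin.update_cons_zero] at this
    rw [hmean, key]
    rw [integral_prod_symm]
    · calc ∫ w, ∫ a, Real.exp (t * (H a w - m)) ∂ρ ∂π
          ≤ ∫ w, Real.exp (t ^ 2 * c ^ 2 / 8) * Real.exp (t * (g w - m)) ∂π := by
            refine integral_mono_of_nonneg (ae_of_all _ fun w => integral_nonneg fun a =>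
              (Real.exp_pos _).le) ?_ (ae_of_all _ hinner)
            refine Integrable.const_mul ?_ _
            exact integrable_of_abs_le (by fun_prop) fun w => hbound _ (hgB w)
        _ = Real.exp (t ^ 2 * c ^ 2 / 8) * ∫ w, Real.exp (t * (g w - m)) ∂π := by
            rw [integral_const_mul]
        _ ≤ Real.exp (t ^ 2 * c ^ 2 / 8) * Real.exp (n * (t ^ 2 * c ^ 2 / 8)) :=
            mul_le_mul_of_nonneg_left (ih g hgm ⟨B, hgB⟩ hgc) (Real.exp_pos _).le
        _ = Real.exp ((n + 1 : ℕ) * (t ^ 2 * c ^ 2 / 8)) := by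
            rw [← Real.exp_add]; push_cast; ring_nf
    · have : Measurable fun p : W × (Fin n → W) => F (Fin.cons p.1 p.2) := hF.comp hcons
      exact integrable_of_abs_le (by fun_prop) fun p => hbound _ (hB _)

/-- McDiarmid's inequality for i.i.d. coordinates. -/
theorem measure_boundedDifferences_ge_le (ρ : Measure W) [IsProbabilityMeasure ρ] {n : ℕ}
    (hn : 0 < n) {c : ℝ} (hc0 : 0 < c) {F : (Fin n → W) → ℝ} (hF : Measurable F)
    (hB : ∃ B, ∀ w, |F w| ≤ B) (hc : ∀ w j a, |F (Function.update w j a) - F w| ≤ c) {u : ℝ}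
    (hu : 0 ≤ u) :
    (Measure.pi fun _ : Fin n => ρ).real
      {w | (∫ w', F w' ∂(Measure.pi fun _ => ρ)) + u ≤ F w} ≤
      Real.exp (-(2 * u ^ 2 / (n * c ^ 2))) := by
  set π : Measure (Fin n → W) := Measure.pi fun _ => ρ
  set e := ∫ w', F w' ∂π with he
  obtain ⟨B, hB⟩ := hB
  have hn' : (0 : ℝ) < n := by exact_mod_cast hn
  -- The minimizer of the Chernoff exponent `-t u + n t² c² / 8`.
  set t : ℝ := 4 * u / (n * c ^ 2) with ht
  have ht0 : 0 ≤ t := by positivity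
  have hint : Integrable (fun w => Real.exp (t * (F w - e))) π := by
    refine integrable_of_abs_le (B := Real.exp (|t| * (B + |e|))) (by fun_prop) fun w => ?_
    rw [abs_of_pos (Real.exp_pos _)]
    refine Real.exp_le_exp.2 ((le_abs_self _).trans ?_)
    rw [abs_mul]
    refine mul_le_mul_of_nonneg_left ?_ (abs_nonneg _)
    exact (abs_sub _ _).trans (by linarith [hB w])
  have h1 := measure_ge_le_exp_mul_mgf (μ := π) (X := fun w => F w - e) u ht0 hint
  have h2 := integral_exp_boundedDifferences ρ t n F hF ⟨B, hB⟩ hc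
  have hset : {w | e + u ≤ F w} = {w | u ≤ F w - e} := by
    ext w; simp only [Set.mem_ofPred_eq]; constructor <;> intro h <;> linarith
  rw [hset]
  refine h1.trans ((mul_le_mul_of_nonneg_left h2 (Real.exp_pos _).le).trans (le_of_eq ?_))
  rw [← Real.exp_add]
  congr 1
  rw [ht]
  field_simp
  ring

end BoundedDifferences

/-! ### Concentration of empirical means in `L²` -/

section EmpiricalMean

variable {W X : Type*} [MeasurableSpace W] [MeasurableSpace X]

/-- Minkowski's inequality for `(∫ ‖·‖²)^{1/2}`. -/
lemma sqrt_integral_norm_sq_add_le {μ : Measure X} {u v : X → ℂ} (hu : MemLp u 2 μ)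
    (hv : MemLp v 2 μ) :
    Real.sqrt (∫ x, ‖u x + v x‖ ^ 2 ∂μ) ≤
      Real.sqrt (∫ x, ‖u x‖ ^ 2 ∂μ) + Real.sqrt (∫ x, ‖v x‖ ^ 2 ∂μ) := by
  have key : ∀ {w : X → ℂ}, MemLp w 2 μ →
      eLpNorm w 2 μ = ENNReal.ofReal (Real.sqrt (∫ x, ‖w x‖ ^ 2 ∂μ)) := by
    intro w hw
    rw [hw.eLpNorm_eq_integral_rpow_norm (by norm_num) (by norm_num), Real.sqrt_eq_rpow]
    norm_num
  have h := eLpNorm_add_le hu.1 hv.1 (p := 2) (by norm_num)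
  rw [key hu, key hv, key (hu.add hv), ← ENNReal.ofReal_add (Real.sqrt_nonneg _)
    (Real.sqrt_nonneg _)] at h
  exact (ENNReal.ofReal_le_ofReal_iff (by positivity)).1 h

lemma memLp_two_of_norm_le {μ : Measure X} [IsFiniteMeasure μ] {u : X → ℂ} (hu : Measurable u)
    {B : ℝ} (hB : ∀ x, ‖u x‖ ≤ B) : MemLp u 2 μ :=
  MemLp.of_bound hu.aestronglyMeasurable B (ae_of_all _ hB)

lemma sqrt_integral_norm_sq_le {μ : Measure X} [IsProbabilityMeasure μ] {u : X → ℂ} {B : ℝ}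
    (hB0 : 0 ≤ B) (hB : ∀ x, ‖u x‖ ≤ B) : Real.sqrt (∫ x, ‖u x‖ ^ 2 ∂μ) ≤ B := by
  refine Real.sqrt_le_iff.2 ⟨hB0, ?_⟩
  have := abs_integral_le_of_abs_le (μ := μ) (F := fun x => ‖u x‖ ^ 2) (B := B ^ 2) fun x => by
    rw [abs_of_nonneg (by positivity)]
    exact pow_le_pow_left₀ (norm_nonneg _) (hB x) 2
  exact (le_abs_self _).trans this

/-- Variances of independent summands add, and each is at most the second moment. -/
lemma integral_sq_sub_mean_le {ρ : Measure W} [IsProbabilityMeasure ρ] {n : ℕ} (hn : 0 < n)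
    {T : W → ℝ} (hT : Measurable T) {B : ℝ} (hB : ∀ w, |T w| ≤ B) :
    ∫ w, ((∫ a, T a ∂ρ) - (1 / (n : ℝ)) * ∑ j, T (w j)) ^ 2 ∂(Measure.pi fun _ : Fin n => ρ) ≤
      (1 / (n : ℝ)) * ∫ a, T a ^ 2 ∂ρ := by
  set π : Measure (Fin n → W) := Measure.pi fun _ => ρ
  have hn' : (n : ℝ) ≠ 0 := by positivity
  have hTi : Integrable T ρ := integrable_of_abs_le hT hB
  have hT2 : MemLp T 2 ρ := MemLp.of_bound hT.aestronglyMeasurable B (ae_of_all _ hB)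
  set Y : Fin n → (Fin n → W) → ℝ := fun j w => T (w j) with hY
  have hmp : ∀ j, MeasurePreserving (fun w : Fin n → W => w j) π ρ := fun j =>
    measurePreserving_eval (fun _ => ρ) j
  have hYlp : ∀ j, MemLp (Y j) 2 π := fun j => hT2.comp_measurePreserving (hmp j)
  have hmean : ∀ j, ∫ w, Y j w ∂π = ∫ a, T a ∂ρ := fun j =>
    integral_comp_eval (μ := fun _ : Fin n => ρ) (i := j) hT.aestronglyMeasurable
  have hind : iIndepFun Y π := iIndepFun_pi fun i => hT.aemeasurable
  have hvar : Var[∑ j, Y j; π] = ∑ j, Var[Y j; π] :=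
    IndepFun.variance_sum (fun j _ => hYlp j) fun i _ j _ hij => hind.indepFun hij
  have hvj : ∀ j, Var[Y j; π] ≤ ∫ a, T a ^ 2 ∂ρ := by
    intro j
    refine (variance_le_expectation_sq (hYlp j).1).trans (le_of_eq ?_)
    exact integral_comp_eval (μ := fun _ : Fin n => ρ) (i := j) (f := fun a => T a ^ 2)
      (hT.pow_const 2).aestronglyMeasurable
  have hsum : ∫ w, (∑ j, Y j) w ∂π = n * ∫ a, T a ∂ρ := by
    simp only [Finset.sum_apply]
    rw [integral_finsetSum _ fun j _ => (hYlp j).integrable (by norm_num)]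
    simp [hmean]
  have heq : ∀ w : Fin n → W, ((∫ a, T a ∂ρ) - (1 / (n : ℝ)) * ∑ j, T (w j)) ^ 2 =
      (1 / (n : ℝ)) ^ 2 * ((∑ j, Y j) w - ∫ w, (∑ j, Y j) w ∂π) ^ 2 := by
    intro w
    rw [hsum]
    simp only [Finset.sum_apply, hY]
    field_simp
    ring
  have hm : AEMeasurable (∑ j, Y j) π := by
    exact Finset.aemeasurable_sum _ fun j _ =>
      (hT.comp (measurable_pi_apply j)).aemeasurable
  simp_rw [heq]
  rw [integral_const_mul, ← variance_eq_integral hm, hvar]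
  calc (1 / (n : ℝ)) ^ 2 * ∑ j, Var[Y j; π] ≤ (1 / (n : ℝ)) ^ 2 * ∑ _j : Fin n, ∫ a, T a ^ 2 ∂ρ := by
        gcongr with j; exact hvj j
    _ = (1 / (n : ℝ)) * ∫ a, T a ^ 2 ∂ρ := by
        simp; field_simp

lemma integral_norm_sq_sub_mean_le {ρ : Measure W} [IsProbabilityMeasure ρ] {n : ℕ} (hn : 0 < n)
    {T : W → ℂ} (hT : Measurable T) {B : ℝ} (hB : ∀ w, ‖T w‖ ≤ B) :
    ∫ w, ‖(∫ a, T a ∂ρ) - (1 / (n : ℂ)) * ∑ j, T (w j)‖ ^ 2 ∂(Measure.pi fun _ : Fin n => ρ) ≤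
      B ^ 2 / n := by
  set π : Measure (Fin n → W) := Measure.pi fun _ => ρ
  have hTi : Integrable T ρ := Integrable.of_bound hT.aestronglyMeasurable B (ae_of_all _ hB)
  have hre : ∀ w, |(T w).re| ≤ B := fun w => (Complex.abs_re_le_norm _).trans (hB w)
  have him : ∀ w, |(T w).im| ≤ B := fun w => (Complex.abs_im_le_norm _).trans (hB w)
  have hrem : Measurable fun w => (T w).re := Complex.measurable_re.comp hT
  have himm : Measurable fun w => (T w).im := Complex.measurable_im.comp hT
  have hB' : ∀ w, 0 ≤ B := fun w => (norm_nonneg _).trans (hB w)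
  have heq : ∀ w : Fin n → W, ‖(∫ a, T a ∂ρ) - (1 / (n : ℂ)) * ∑ j, T (w j)‖ ^ 2 =
      ((∫ a, (T a).re ∂ρ) - (1 / (n : ℝ)) * ∑ j, (T (w j)).re) ^ 2 +
      ((∫ a, (T a).im ∂ρ) - (1 / (n : ℝ)) * ∑ j, (T (w j)).im) ^ 2 := by
    intro w
    rw [← Complex.normSq_eq_norm_sq, Complex.normSq_apply, ← integral_re_add_im hTi]
    have : (1 / (n : ℂ)) = ((1 / (n : ℝ) : ℝ) : ℂ) := by push_cast; rfl
    rw [this]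
    simp
    ring
  have hint : ∀ S : W → ℝ, Measurable S → (∀ w, |S w| ≤ B) →
      Integrable (fun w : Fin n → W => ((∫ a, S a ∂ρ) - (1 / (n : ℝ)) * ∑ j, S (w j)) ^ 2) π := by
    intro S hS hSB
    refine integrable_of_abs_le (B := (B + |1 / (n : ℝ)| * ∑ _j : Fin n, B) ^ 2) (by fun_prop)
      fun w => ?_
    rw [abs_pow]
    refine pow_le_pow_left₀ (abs_nonneg _) ((abs_sub _ _).trans ?_) 2
    rw [abs_mul]
    gcongr
    · exact abs_integral_le_of_abs_le hSB
    · exact (Finset.abs_sum_le_sum_abs _ _).trans (Finset.sum_le_sum fun j _ => hSB _)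
  simp_rw [heq]
  rw [integral_add (hint _ hrem hre) (hint _ himm him)]
  refine (add_le_add (integral_sq_sub_mean_le hn hrem hre)
    (integral_sq_sub_mean_le hn himm him)).trans ?_
  rw [← mul_add, ← integral_add]
  · have h1 : ∀ a, (T a).re ^ 2 + (T a).im ^ 2 = ‖T a‖ ^ 2 := fun a => by
      rw [← Complex.normSq_eq_norm_sq, Complex.normSq_apply]; ring
    simp_rw [h1]
    have h2 : ∫ a, ‖T a‖ ^ 2 ∂ρ ≤ B ^ 2 := (le_abs_self _).trans
      (abs_integral_le_of_abs_le fun a => by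
        rw [abs_of_nonneg (by positivity)]
        exact pow_le_pow_left₀ (norm_nonneg _) (hB a) 2)
    calc 1 / (n : ℝ) * ∫ a, ‖T a‖ ^ 2 ∂ρ ≤ 1 / (n : ℝ) * B ^ 2 := by gcongr
      _ = B ^ 2 / n := by ring
  · refine integrable_of_abs_le (B := B ^ 2) (by fun_prop) fun w => ?_
    rw [abs_pow]; exact pow_le_pow_left₀ (abs_nonneg _) (hre w) 2
  · refine integrable_of_abs_le (B := B ^ 2) (by fun_prop) fun w => ?_
    rw [abs_pow]; exact pow_le_pow_left₀ (abs_nonneg _) (him w) 2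

/-- Concentration, in `L²(Q)`, of the empirical mean of bounded i.i.d. random functions. -/
theorem measure_empiricalMean_ge_le (ρ : Measure W) [IsProbabilityMeasure ρ] (Q : Measure X)
    [IsProbabilityMeasure Q] {n : ℕ} (hn : 0 < n) {T : W → X → ℂ}
    (hT : Measurable (Function.uncurry T)) {B : ℝ} (hB0 : 0 < B) (hB : ∀ w x, ‖T w x‖ ≤ B) {a : ℝ}
    (ha : 0 ≤ a) :
    (Measure.pi fun _ : Fin n => ρ).real
      {w | B / Real.sqrt n * (1 + Real.sqrt (2 * a)) ≤
        Real.sqrt (∫ x, ‖(∫ b, T b x ∂ρ) - (1 / (n : ℂ)) * ∑ j, T (w j) x‖ ^ 2 ∂Q)} ≤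
      Real.exp (-a) := by
  set π : Measure (Fin n → W) := Measure.pi fun _ => ρ
  have hn' : (0 : ℝ) < n := by exact_mod_cast hn
  set D : (Fin n → W) → X → ℂ :=
    fun w x => (∫ b, T b x ∂ρ) - (1 / (n : ℂ)) * ∑ j, T (w j) x with hD
  set F : (Fin n → W) → ℝ := fun w => Real.sqrt (∫ x, ‖D w x‖ ^ 2 ∂Q) with hFdef
  have hmean : Measurable fun x => ∫ b, T b x ∂ρ :=
    (StronglyMeasurable.integral_prod_left (μ := ρ) hT.stronglyMeasurable).measurable
  have hDm : Measurable (Function.uncurry D) := by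
    refine (hmean.comp measurable_snd).sub (Measurable.const_mul ?_ _)
    refine Finset.measurable_sum _ fun j _ => ?_
    have : Measurable fun p : (Fin n → W) × X => (p.1 j, p.2) := by fun_prop
    exact hT.comp this
  have hD1 : ∀ w, Measurable (D w) := fun w => hDm.comp measurable_prodMk_left
  have hDB : ∀ w x, ‖D w x‖ ≤ 2 * B := by
    intro w x
    refine (norm_sub_le _ _).trans ?_
    have h1 : ‖∫ b, T b x ∂ρ‖ ≤ B := by
      simpa using norm_integral_le_of_norm_le_const (μ := ρ) (ae_of_all _ fun b => hB b x)
    have h2 : ‖(1 / (n : ℂ)) * ∑ j, T (w j) x‖ ≤ B := by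
      rw [norm_mul]
      calc ‖(1 / (n : ℂ))‖ * ‖∑ j, T (w j) x‖ ≤ (1 / (n : ℝ)) * ∑ _j : Fin n, B := by
            gcongr
            · simp
            · exact (norm_sum_le _ _).trans (Finset.sum_le_sum fun j _ => hB _ _)
        _ = B := by simp; field_simp
    linarith
  have hDsq : Measurable fun p : (Fin n → W) × X => ‖D p.1 p.2‖ ^ 2 := (hDm.norm).pow_const 2
  have hFm : Measurable F := by
    refine Measurable.sqrt ?_
    exact (StronglyMeasurable.integral_prod_right (ν := Q)
      (f := fun w x => ‖D w x‖ ^ 2) hDsq.stronglyMeasurable).measurable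
  have hF0 : ∀ w, 0 ≤ F w := fun w => Real.sqrt_nonneg _
  have hFB : ∀ w, |F w| ≤ 2 * B := fun w => by
    rw [abs_of_nonneg (hF0 w)]
    exact sqrt_integral_norm_sq_le (by positivity) (hDB w)
  -- Minkowski's inequality makes `F` Lipschitz for uniform perturbations of `D`; resampling one
  -- coordinate perturbs the mean by at most `2B/n`.
  have hdiff : ∀ w w' : Fin n → W, (∀ x, ‖D w x - D w' x‖ ≤ 2 * B / n) → F w - F w' ≤ 2 * B / n := by
    intro w w' h
    have h1 := sqrt_integral_norm_sq_add_le (μ := Q) (u := D w') (v := fun x => D w x - D w' x)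
      (memLp_two_of_norm_le (hD1 w') (hDB w'))
      (memLp_two_of_norm_le ((hD1 w).sub (hD1 w')) h)
    have h2 := sqrt_integral_norm_sq_le (μ := Q) (by positivity) h
    simp only [add_sub_cancel] at h1
    simp only [hFdef]
    linarith
  have hpt : ∀ (w : Fin n → W) j b x, ‖D (Function.update w j b) x - D w x‖ ≤ 2 * B / n := by
    intro w j b x
    have : D (Function.update w j b) x - D w x = (1 / (n : ℂ)) * (T (w j) x - T b x) := by
      have hs : ∑ i, T (Function.update w j b i) x = ∑ i, T (w i) x + (T b x - T (w j) x) := by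
        rw [← sub_eq_iff_eq_add', ← Finset.sum_sub_distrib, Finset.sum_eq_single j]
        · simp
        · intro i _ hij; simp [Function.update_of_ne hij]
        · simp
      simp only [hD, hs]; ring
    rw [this, norm_mul]
    have h1 : ‖T (w j) x - T b x‖ ≤ 2 * B := (norm_sub_le _ _).trans (by linarith [hB (w j) x, hB b x])
    calc ‖(1 / (n : ℂ))‖ * ‖T (w j) x - T b x‖ ≤ (1 / (n : ℝ)) * (2 * B) := by
          gcongr; simp
      _ = 2 * B / n := by ring
  have hFc : ∀ w j b, |F (Function.update w j b) - F w| ≤ 2 * B / n := by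
    intro w j b
    refine abs_sub_le_iff.2 ⟨hdiff _ _ (hpt w j b), hdiff _ _ fun x => ?_⟩
    rw [norm_sub_rev]; exact hpt w j b x
  have hFsq : Integrable (fun w => F w ^ 2) π := integrable_of_abs_le (B := (2 * B) ^ 2)
    (hFm.pow_const 2) fun w => by
      rw [abs_pow]; exact pow_le_pow_left₀ (abs_nonneg _) (hFB w) 2
  have hEsq : ∫ w, F w ^ 2 ∂π ≤ B ^ 2 / n := by
    have h1 : ∀ w, F w ^ 2 = ∫ x, ‖D w x‖ ^ 2 ∂Q := fun w =>
      Real.sq_sqrt (integral_nonneg fun x => by positivity)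
    simp_rw [h1]
    rw [integral_integral_swap]
    · refine (le_abs_self _).trans (abs_integral_le_of_abs_le fun x => ?_)
      rw [abs_of_nonneg (integral_nonneg fun w => by positivity)]
      exact integral_norm_sq_sub_mean_le hn (hT.comp measurable_prodMk_right) fun w => hB w x
    · refine integrable_of_abs_le (B := (2 * B) ^ 2) hDsq fun p => ?_
      rw [abs_of_nonneg (sq_nonneg _)]
      exact pow_le_pow_left₀ (norm_nonneg _) (hDB _ _) 2
  -- Jensen's inequality, in the form of nonnegative variance, passes from the second moment to the
  -- mean.
  have hE : ∫ w, F w ∂π ≤ B / Real.sqrt n := by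
    have hv := variance_nonneg F π
    have hlp : MemLp F 2 π := MemLp.of_bound hFm.aestronglyMeasurable (2 * B) (ae_of_all _ hFB)
    rw [variance_eq_sub hlp] at hv
    have h2 : (∫ w, F w ∂π) ^ 2 ≤ (B / Real.sqrt n) ^ 2 := by
      rw [div_pow, Real.sq_sqrt hn'.le]
      simp only [Pi.pow_apply] at hv
      linarith
    exact (pow_le_pow_iff_left₀ (integral_nonneg hF0) (by positivity) (by norm_num)).1 h2
  have hmc := measure_boundedDifferences_ge_le ρ hn (c := 2 * B / n) (by positivity) hFm
    ⟨_, hFB⟩ hFc (u := B / Real.sqrt n * Real.sqrt (2 * a)) (by positivity)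
  have hexp : 2 * (B / Real.sqrt n * Real.sqrt (2 * a)) ^ 2 / (n * (2 * B / n) ^ 2) = a := by
    rw [mul_pow, div_pow, Real.sq_sqrt hn'.le, Real.sq_sqrt (by positivity)]
    field_simp
  rw [hexp] at hmc
  refine (measureReal_mono ?_).trans hmc
  intro w hw
  simp only [Set.mem_ofPred_eq] at hw ⊢
  refine le_trans ?_ hw
  rw [mul_add, mul_one]
  gcongr

end EmpiricalMean

/-! ### Gaussian integrals -/

section SphericalGaussian

variable {d : ℕ}

lemma gaussianDensity_pos (d : ℕ) {σ : ℝ} (hσ : 0 < σ) (ω : EuclideanSpace ℝ (Fin d)) :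
    0 < gaussianDensity d σ ω := by
  unfold gaussianDensity
  have := Real.pi_pos
  positivity

lemma continuous_gaussianDensity (d : ℕ) (σ : ℝ) : Continuous (gaussianDensity d σ) := by
  unfold gaussianDensity
  fun_prop

lemma integral_sphericalGaussian {σ : ℝ} (hσ : 0 < σ) (F : EuclideanSpace ℝ (Fin d) → ℂ) :
    ∫ ω, F ω ∂(sphericalGaussian d σ) = ∫ ω, (gaussianDensity d σ ω : ℂ) * F ω := by
  unfold sphericalGaussian
  rw [integral_withDensity_eq_integral_toReal_smul]
  · refine integral_congr_ae (ae_of_all _ fun ω => ?_)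
    simp only
    rw [ENNReal.toReal_ofReal (gaussianDensity_pos d hσ ω).le, Complex.real_smul]
  · exact (continuous_gaussianDensity d σ).measurable.ennreal_ofReal
  · exact ae_of_all _ fun ω => ENNReal.ofReal_lt_top

/-- A common source for three integrals: `a = c = 0` gives the total mass, `a = 0` and `c = i` the
characteristic function, and `a = γ²/2`, `c = γ²` the average of the Gaussian kernel. -/
lemma integral_cexp_sphericalGaussian {σ : ℝ} (hσ : 0 < σ) {a : ℝ} (ha : 0 ≤ a) (c : ℂ)
    (u : EuclideanSpace ℝ (Fin d)) :
    ∫ x, Complex.exp (-(a : ℂ) * (‖x‖ : ℂ) ^ 2 + c * (inner ℝ u x : ℝ)) ∂(sphericalGaussian d σ) =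
      (((1 + 2 * a * σ ^ 2) ^ (-((d : ℝ) / 2)) : ℝ) : ℂ) *
        Complex.exp (c ^ 2 * (‖u‖ : ℂ) ^ 2 / (4 * ((1 / (2 * σ ^ 2) + a : ℝ) : ℂ))) := by
  have hπ := Real.pi_pos
  set b : ℝ := 1 / (2 * σ ^ 2) + a with hb
  have hb0 : 0 < b := by positivity
  rw [integral_sphericalGaussian hσ]
  have h1 : ∀ x : EuclideanSpace ℝ (Fin d), (gaussianDensity d σ x : ℂ) *
      Complex.exp (-(a : ℂ) * (‖x‖ : ℂ) ^ 2 + c * (inner ℝ u x : ℝ)) =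
      (((2 * Real.pi * σ ^ 2) ^ (-((d : ℝ) / 2)) : ℝ) : ℂ) *
        Complex.exp (-(b : ℂ) * (‖x‖ : ℂ) ^ 2 + c * (inner ℝ u x : ℝ)) := by
    intro x
    unfold gaussianDensity
    rw [Complex.ofReal_mul, mul_assoc, Complex.ofReal_exp, ← Complex.exp_add]
    congr 2
    rw [hb]
    push_cast
    ring
  simp_rw [h1]
  rw [integral_const_mul, GaussianFourier.integral_cexp_neg_mul_sq_norm_add (by simpa using hb0),
    ← mul_assoc]
  congr 1
  rw [finrank_euclideanSpace, Fintype.card_fin]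
  have h2 : ((Real.pi : ℂ) / (b : ℂ)) ^ ((d : ℂ) / 2) =
      (((Real.pi / b) ^ ((d : ℝ) / 2) : ℝ) : ℂ) := by
    rw [Complex.ofReal_cpow (by positivity)]
    push_cast
    rfl
  rw [h2, ← Complex.ofReal_mul]
  congr 1
  have h3 : Real.pi / b = (2 * Real.pi * σ ^ 2) * (1 + 2 * a * σ ^ 2)⁻¹ := by
    rw [hb]; field_simp
  rw [h3, Real.mul_rpow (x := 2 * Real.pi * σ ^ 2) (by positivity) (by positivity), ← mul_assoc,
    ← Real.rpow_add (by positivity), neg_add_cancel, Real.rpow_zero, one_mul,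
    Real.inv_rpow (by positivity), Real.rpow_neg (by positivity)]

lemma isProbabilityMeasure_sphericalGaussian (d : ℕ) {σ : ℝ} (hσ : 0 < σ) :
    IsProbabilityMeasure (sphericalGaussian d σ) := by
  have h := integral_cexp_sphericalGaussian (d := d) hσ le_rfl 0 0
  simp at h
  have h2 : (sphericalGaussian d σ).real Set.univ = 1 := by exact_mod_cast h
  refine ⟨?_⟩
  rw [Measure.real, ENNReal.toReal_eq_one_iff] at h2
  exact h2

lemma integral_fourierFeature {γ : ℝ} (hγ : 0 < γ) (u : EuclideanSpace ℝ (Fin d)) :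
    ∫ x, fourierFeature x u ∂(sphericalGaussian d γ) =
      (Real.exp (-(γ ^ 2 * ‖u‖ ^ 2 / 2)) : ℂ) := by
  have h := integral_cexp_sphericalGaussian (d := d) hγ le_rfl Complex.I u
  simp only [Complex.ofReal_zero, neg_zero, zero_mul, zero_add, mul_zero, add_zero,
    Real.one_rpow, Complex.ofReal_one, one_mul, Complex.I_sq] at h
  have h1 : ∀ x : EuclideanSpace ℝ (Fin d), fourierFeature x u =
      Complex.exp (Complex.I * ((inner ℝ u x : ℝ) : ℂ)) := fun x => by
    rw [fourierFeature, real_inner_comm]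
  simp_rw [h1]
  rw [h]
  rw [Complex.ofReal_exp]
  congr 1
  push_cast
  field_simp
  ring

/-- The integral has a closed form whose dependence on `u` is a factor at most `1`, the worst center
being the origin. -/
lemma integral_exp_neg_dist_sq_le {σ γ : ℝ} (hσ : 0 < σ) (u : EuclideanSpace ℝ (Fin d)) :
    ∫ w, Real.exp (-(γ ^ 2 * ‖w - u‖ ^ 2 / 2)) ∂(sphericalGaussian d σ) ≤
      (1 + γ ^ 2 * σ ^ 2) ^ (-((d : ℝ) / 2)) := by
  have h := integral_cexp_sphericalGaussian (d := d) hσ (a := γ ^ 2 / 2) (by positivity)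
    ((γ ^ 2 : ℝ) : ℂ) u
  set b : ℝ := 1 / (2 * σ ^ 2) + γ ^ 2 / 2 with hb
  have hb0 : 0 < b := by positivity
  have h1 : ∀ w : EuclideanSpace ℝ (Fin d),
      ((Real.exp (-(γ ^ 2 * ‖w - u‖ ^ 2 / 2)) : ℝ) : ℂ) =
      (Real.exp (-(γ ^ 2 * ‖u‖ ^ 2 / 2)) : ℂ) * Complex.exp (-((γ ^ 2 / 2 : ℝ) : ℂ) * (‖w‖ : ℂ) ^ 2 +
        ((γ ^ 2 : ℝ) : ℂ) * (inner ℝ u w : ℝ)) := by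
    intro w
    rw [norm_sub_sq_real, real_inner_comm, Complex.ofReal_exp, Complex.ofReal_exp,
      ← Complex.exp_add]
    congr 1
    push_cast
    ring
  have h2 : ((∫ w, Real.exp (-(γ ^ 2 * ‖w - u‖ ^ 2 / 2)) ∂(sphericalGaussian d σ) : ℝ) : ℂ) =
      ((Real.exp (-(γ ^ 2 * ‖u‖ ^ 2 / 2)) * ((1 + γ ^ 2 * σ ^ 2) ^ (-((d : ℝ) / 2)) *
        Real.exp ((γ ^ 2) ^ 2 * ‖u‖ ^ 2 / (4 * b))) : ℝ) : ℂ) := by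
    rw [← integral_complex_ofReal]
    simp_rw [h1]
    rw [integral_const_mul, h]
    push_cast
    congr 5
    ring
  rw [Complex.ofReal_inj] at h2
  rw [h2, mul_left_comm, ← Real.exp_add]
  refine mul_le_of_le_one_right (by positivity) (Real.exp_le_one_iff.2 ?_)
  have h3 : (γ ^ 2) ^ 2 * ‖u‖ ^ 2 / (4 * b) ≤ γ ^ 2 * ‖u‖ ^ 2 / 2 := by
    rw [div_le_iff₀ (by positivity), hb]
    have : 0 ≤ γ ^ 2 * ‖u‖ ^ 2 * (1 / σ ^ 2) := by positivity
    have e : γ ^ 2 * ‖u‖ ^ 2 / 2 * (4 * (1 / (2 * σ ^ 2) + γ ^ 2 / 2)) =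
      γ ^ 2 * ‖u‖ ^ 2 * (1 / σ ^ 2) + (γ ^ 2) ^ 2 * ‖u‖ ^ 2 := by field_simp; ring
    rw [e]; linarith
  linarith

end SphericalGaussian

/-! ### Tail bounds for kernel row sums and Gaussian noise -/

section Tails

/-- An upper tail bound for the row sums of a random kernel matrix with entries in `[0, 1]`. -/
lemma measure_kernel_rowSum_ge_le {W : Type*} [MeasurableSpace W] (ρ : Measure W)
    [IsProbabilityMeasure ρ] {k : W → W → ℝ} (hk : Measurable (Function.uncurry k))
    (h0 : ∀ a b, 0 ≤ k a b) (h1 : ∀ a b, k a b ≤ 1) {p : ℝ} (hp0 : 0 ≤ p)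
    (hp : ∀ b, ∫ a, k a b ∂ρ ≤ p) {N : ℕ} (j : Fin N) (t : ℝ) :
    (Measure.pi fun _ : Fin N => ρ).real {w | 1 + 2 * N * p + t ≤ ∑ l, k (w l) (w j)} ≤
      Real.exp (-t) := by
  obtain ⟨n, rfl⟩ : ∃ n, N = n + 1 := ⟨N - 1, by have := j.pos; omega⟩
  set π : Measure (Fin (n + 1) → W) := Measure.pi fun _ => ρ
  set Z : (Fin (n + 1) → W) → ℝ := fun w => ∑ i : Fin n, k (w (j.succAbove i)) (w j) with hZ
  have hkm : ∀ i l : Fin (n + 1), Measurable fun w : Fin (n + 1) → W => k (w i) (w l) :=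
    fun i l => by
      have : Measurable fun w : Fin (n + 1) → W => (w i, w l) := by fun_prop
      exact hk.comp this
  have hZm : Measurable Z := Finset.measurable_sum _ fun i _ => hkm _ _
  have hZB : ∀ w, |Z w| ≤ n := by
    intro w
    refine (Finset.abs_sum_le_sum_abs _ _).trans ?_
    calc ∑ i : Fin n, |k (w (j.succAbove i)) (w j)| ≤ ∑ _i : Fin n, (1 : ℝ) :=
          Finset.sum_le_sum fun i _ => by rw [abs_of_nonneg (h0 _ _)]; exact h1 _ _
      _ = n := by simp
  -- The chord of the convex exponential on `[0, 1]` has slope `e - 1 < 2`.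
  have hexp : ∀ x : ℝ, 0 ≤ x → x ≤ 1 → Real.exp x ≤ 1 + 2 * x := by
    intro x hx0 hx1
    have hc := convexOn_exp.2 (Set.mem_univ (0 : ℝ)) (Set.mem_univ (1 : ℝ))
      (sub_nonneg.2 hx1) hx0 (by ring)
    simp only [smul_eq_mul, mul_zero, mul_one, zero_add, Real.exp_zero] at hc
    have he := Real.exp_one_lt_d9
    nlinarith
  have hk1 : ∀ b, Measurable fun a => k a b := fun b => hk.comp measurable_prodMk_right
  have hmgf1 : ∀ b, ∫ a, Real.exp (k a b) ∂ρ ≤ Real.exp (2 * p) := by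
    intro b
    have hki : Integrable (fun a => k a b) ρ := integrable_of_abs_le (B := 1) (hk1 b) fun a => by
      rw [abs_of_nonneg (h0 _ _)]; exact h1 _ _
    calc ∫ a, Real.exp (k a b) ∂ρ ≤ ∫ a, (1 + 2 * k a b) ∂ρ := by
          refine integral_mono_of_nonneg (ae_of_all _ fun a => (Real.exp_pos _).le)
            ((integrable_const _).add (hki.const_mul 2)) (ae_of_all _ fun a => hexp _ (h0 _ _) (h1 _ _))
      _ = 1 + 2 * ∫ a, k a b ∂ρ := by
          rw [integral_add (integrable_const _) (hki.const_mul 2), integral_const_mul]; simp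
      _ ≤ 1 + 2 * p := by linarith [hp b]
      _ ≤ Real.exp (2 * p) := by linarith [Real.add_one_le_exp (2 * p)]
  have hint : ∀ s : ℝ, Integrable (fun w => Real.exp (s * Z w)) π := fun s =>
    integrable_of_abs_le (B := Real.exp (|s| * n)) (by fun_prop) fun w => by
      rw [abs_of_pos (Real.exp_pos _)]
      refine Real.exp_le_exp.2 ((le_abs_self _).trans ?_)
      rw [abs_mul]
      exact mul_le_mul_of_nonneg_left (hZB w) (abs_nonneg _)
  have hmgf : mgf Z π 1 ≤ Real.exp (2 * n * p) := by
    have hmp := measurePreserving_piFinSuccAbove (fun _ : Fin (n + 1) => ρ) j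
    set G : W × (Fin n → W) → ℝ := fun q => ∏ i, Real.exp (k (q.2 i) q.1) with hG
    have hGm : Measurable G := by
      refine Finset.measurable_prod _ fun i _ => Real.measurable_exp.comp ?_
      have : Measurable fun q : W × (Fin n → W) => (q.2 i, q.1) := by fun_prop
      exact hk.comp this
    have e1 : mgf Z π 1 = ∫ q, G q ∂(ρ.prod (Measure.pi fun _ : Fin n => ρ)) := by
      rw [← hmp.integral_comp' G, mgf]
      refine integral_congr_ae (ae_of_all _ fun w => ?_)
      simp only [one_mul, hZ, Real.exp_sum]
      rfl
    -- Conditionally on `w j` the off-diagonal entries are independent, so the moment generating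
    -- function factorizes.
    rw [e1, integral_prod]
    · have e2 : ∀ a, ∫ w', G (a, w') ∂(Measure.pi fun _ : Fin n => ρ) =
          (∫ b, Real.exp (k b a) ∂ρ) ^ n := by
        intro a
        have := integral_fintype_prod_eq_pow (ι := Fin n) (μ := ρ) (fun b => Real.exp (k b a))
        simpa using this
      simp_rw [e2]
      refine (le_abs_self _).trans (abs_integral_le_of_abs_le fun a => ?_)
      have hnn : 0 ≤ ∫ b, Real.exp (k b a) ∂ρ := integral_nonneg fun b => (Real.exp_pos _).le
      rw [abs_of_nonneg (pow_nonneg hnn _)]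
      calc (∫ b, Real.exp (k b a) ∂ρ) ^ n ≤ Real.exp (2 * p) ^ n := pow_le_pow_left₀ hnn (hmgf1 a) n
        _ = Real.exp (2 * n * p) := by rw [← Real.exp_nat_mul]; ring_nf
    · refine integrable_of_abs_le (B := ∏ _i : Fin n, Real.exp 1) hGm fun q => ?_
      rw [Finset.abs_prod]
      refine Finset.prod_le_prod (fun i _ => abs_nonneg _) fun i _ => ?_
      rw [abs_of_pos (Real.exp_pos _)]
      exact Real.exp_le_exp.2 (h1 _ _)
  have hmk := measure_ge_le_exp_mul_mgf (μ := π) (X := Z) (2 * (n + 1 : ℕ) * p + t) zero_le_one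
    (hint 1)
  refine (measureReal_mono ?_).trans (hmk.trans ?_)
  · intro w hw
    -- The diagonal entry is at most `1`; this accounts for the leading `1` in the threshold.
    simp only [Set.mem_ofPred_eq] at hw ⊢
    rw [Fin.sum_univ_succAbove _ j] at hw
    have := h1 (w j) (w j)
    simp only [hZ]
    linarith
  · refine (mul_le_mul_of_nonneg_left hmgf (Real.exp_pos _).le).trans ?_
    rw [← Real.exp_add]
    refine Real.exp_le_exp.2 ?_
    push_cast
    linarith

lemma mgf_sq_gaussianReal {v : NNReal} (hv : v ≠ 0) :
    ∫ x, Real.exp (1 * (x ^ 2 / (4 * v))) ∂(gaussianReal 0 v) = Real.sqrt 2 := by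
  have hv' : (0 : ℝ) < v := by positivity
  have hπ := Real.pi_pos
  rw [integral_gaussianReal_eq_integral_smul hv]
  have h1 : ∀ x : ℝ, gaussianPDFReal 0 v x • Real.exp (1 * (x ^ 2 / (4 * v))) =
      (Real.sqrt (2 * Real.pi * v))⁻¹ * Real.exp (-(1 / (4 * v)) * x ^ 2) := by
    intro x
    rw [gaussianPDFReal, smul_eq_mul, mul_assoc, ← Real.exp_add]
    congr 2
    field_simp
    ring
  simp_rw [h1]
  rw [integral_const_mul, integral_gaussian, ← Real.sqrt_inv, ← Real.sqrt_mul (by positivity)]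
  congr 1
  field_simp
  ring

/-- Chernoff at half the critical exponent, where each `g² / (4v)` has exponential moment `√2 ≤
e^(1/2)`: the threshold contributes `e^(-m)` and the moments at most `e^(m/2)`. -/
lemma measure_sum_sq_gaussian_ge_le {Ω : Type*} [MeasurableSpace Ω] {P : Measure Ω}
    [IsProbabilityMeasure P] {m : ℕ} {v : NNReal} (hv : v ≠ 0) {g : Fin m → Ω → ℝ}
    (hg : ∀ k, HasLaw (g k) (gaussianReal 0 v) P) (hi : iIndepFun g P) :
    P.real {τ | 4 * (v : ℝ) * m ≤ ∑ k, g k τ ^ 2} ≤ Real.exp (-(m / 2)) := by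
  have hv' : (0 : ℝ) < v := by positivity
  set q : ℝ → ℝ := fun x => x ^ 2 / (4 * v) with hq
  have hqm : Measurable q := by fun_prop
  set X : Fin m → Ω → ℝ := fun k => q ∘ g k with hX
  have hXi : iIndepFun X P := hi.comp (fun _ => q) fun _ => hqm
  have hXm : ∀ k, AEMeasurable (X k) P := fun k => hqm.comp_aemeasurable (hg k).aemeasurable
  have hmgf : ∀ k, mgf (X k) P 1 = Real.sqrt 2 := by
    intro k
    rw [← mgf_sq_gaussianReal hv]
    exact (hg k).integral_comp (f := fun x => Real.exp (1 * q x))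
      (by fun_prop : Measurable fun x => Real.exp (1 * q x)).aestronglyMeasurable
  have hprod : mgf (∑ k, X k) P 1 = ∏ _k : Fin m, Real.sqrt 2 := by
    rw [hXi.mgf_sum₀ hXm]; simp only [hmgf]
  -- Integrability is read off from `hprod`: a non-integrable function would have integral `0`, yet
  -- the product is positive.
  have hsum : Integrable (fun τ => Real.exp (1 * (∑ k, X k) τ)) P := by
    by_contra h
    have h0 := integral_undef h
    rw [mgf, h0] at hprod
    have h2 : 0 < ∏ _k : Fin m, Real.sqrt 2 := Finset.prod_pos fun _ _ => by positivity
    linarith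
  have hmk := measure_ge_le_exp_mul_mgf (μ := P) (X := ∑ k, X k) m zero_le_one hsum
  rw [hprod] at hmk
  have hset : {τ | 4 * (v : ℝ) * m ≤ ∑ k, g k τ ^ 2} ⊆ {τ | (m : ℝ) ≤ (∑ k, X k) τ} := by
    intro τ hτ
    simp only [Set.mem_ofPred_eq, Finset.sum_apply, hX, Function.comp, hq] at hτ ⊢
    rw [← Finset.sum_div, le_div_iff₀ (by positivity)]
    linarith
  refine (measureReal_mono hset).trans (hmk.trans ?_)
  have h2 : Real.sqrt 2 ≤ Real.exp (1 / 2) := by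
    rw [Real.sqrt_le_left (Real.exp_pos _).le, ← Real.exp_nat_mul]
    have := Real.exp_one_gt_d9
    norm_num
    linarith
  calc Real.exp (-1 * m) * ∏ _k : Fin m, Real.sqrt 2
      ≤ Real.exp (-1 * m) * ∏ _k : Fin m, Real.exp (1 / 2) := by gcongr
    _ = Real.exp (-(m / 2)) := by
        simp only [Finset.prod_const, Finset.card_univ, Fintype.card_fin]
        rw [← Real.exp_nat_mul, ← Real.exp_add]; ring_nf

end Tails

/-! ### Energies of Fourier feature expansions -/

section Features

variable {d : ℕ}

lemma norm_fourierFeature (x u : EuclideanSpace ℝ (Fin d)) : ‖fourierFeature x u‖ = 1 := by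
  rw [fourierFeature, mul_comm, Complex.norm_exp_ofReal_mul_I]

lemma fourierFeature_mul_conj (x u v : EuclideanSpace ℝ (Fin d)) :
    fourierFeature x u * (starRingEnd ℂ) (fourierFeature x v) = fourierFeature x (u - v) := by
  unfold fourierFeature
  rw [← Complex.exp_conj, ← Complex.exp_add, inner_sub_right]
  congr 1
  simp
  ring

lemma continuous_fourierFeature :
    Continuous fun p : EuclideanSpace ℝ (Fin d) × EuclideanSpace ℝ (Fin d) =>
      fourierFeature p.1 p.2 := by
  unfold fourierFeature
  fun_prop

lemma continuous_fourierFeature_left (u : EuclideanSpace ℝ (Fin d)) :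
    Continuous fun x => fourierFeature x u := by
  unfold fourierFeature
  fun_prop

lemma continuous_prunedExpansion {N : ℕ} (w : Fin N → EuclideanSpace ℝ (Fin d)) (c : Fin N → ℂ)
    (S : Finset (Fin N)) : Continuous (prunedExpansion w c S) := by
  unfold prunedExpansion
  exact continuous_finsetSum _ fun j _ => continuous_const.mul (continuous_fourierFeature_left _)

lemma norm_prunedExpansion_le {N : ℕ} (w : Fin N → EuclideanSpace ℝ (Fin d)) (c : Fin N → ℂ)
    (S : Finset (Fin N)) (x : EuclideanSpace ℝ (Fin d)) :
    ‖prunedExpansion w c S x‖ ≤ l1Norm c := by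
  refine (norm_sum_le _ _).trans ?_
  simp only [norm_mul, norm_fourierFeature, mul_one]
  exact Finset.sum_le_sum_of_subset_of_nonneg (Finset.subset_univ _) fun _ _ _ => norm_nonneg _

lemma memLp_prunedExpansion {N : ℕ} (μ : Measure (EuclideanSpace ℝ (Fin d))) [IsFiniteMeasure μ]
    (w : Fin N → EuclideanSpace ℝ (Fin d)) (c : Fin N → ℂ) (S : Finset (Fin N)) :
    MemLp (prunedExpansion w c S) 2 μ :=
  memLp_two_of_norm_le (continuous_prunedExpansion w c S).measurable
    (norm_prunedExpansion_le w c S)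

lemma norm_sq_prunedExpansion {N : ℕ} (w : Fin N → EuclideanSpace ℝ (Fin d)) (c : Fin N → ℂ)
    (x : EuclideanSpace ℝ (Fin d)) :
    ((‖prunedExpansion w c Finset.univ x‖ ^ 2 : ℝ) : ℂ) =
      ∑ j, ∑ l, c j * (starRingEnd ℂ) (c l) * fourierFeature x (w j - w l) := by
  rw [Complex.ofReal_pow, ← Complex.mul_conj', prunedExpansion, map_sum, Finset.sum_mul_sum]
  refine Finset.sum_congr rfl fun j _ => Finset.sum_congr rfl fun l _ => ?_
  rw [map_mul, ← fourierFeature_mul_conj]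
  ring

lemma integral_norm_sq_prunedExpansion {N : ℕ} (μ : Measure (EuclideanSpace ℝ (Fin d)))
    [IsProbabilityMeasure μ] (w : Fin N → EuclideanSpace ℝ (Fin d)) (c : Fin N → ℂ) :
    ((∫ x, ‖prunedExpansion w c Finset.univ x‖ ^ 2 ∂μ : ℝ) : ℂ) =
      ∑ j, ∑ l, c j * (starRingEnd ℂ) (c l) * ∫ x, fourierFeature x (w j - w l) ∂μ := by
  have hint : ∀ u, Integrable (fun x => fourierFeature x u) μ := fun u =>
    Integrable.of_bound (continuous_fourierFeature_left u).measurable.aestronglyMeasurable 1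
      (ae_of_all _ fun x => (norm_fourierFeature x u).le)
  rw [← integral_complex_ofReal]
  simp_rw [norm_sq_prunedExpansion]
  rw [integral_finsetSum _ fun j _ => integrable_finsetSum _ fun l _ => (hint _).const_mul _]
  refine Finset.sum_congr rfl fun j _ => ?_
  rw [integral_finsetSum _ fun l _ => (hint _).const_mul _]
  exact Finset.sum_congr rfl fun l _ => integral_const_mul _ _

/-- The population energy of an expansion is controlled by its empirical energy, as soon as the
empirical characteristic function is uniformly close to the true one at frequency differences. -/
lemma integral_norm_sq_prunedExpansion_le {m N : ℕ} (μ : Measure (EuclideanSpace ℝ (Fin d)))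
    [IsProbabilityMeasure μ] (x : Fin m → EuclideanSpace ℝ (Fin d))
    (w : Fin N → EuclideanSpace ℝ (Fin d)) (c : Fin N → ℂ) {Δ : ℝ}
    (hΔ : ∀ j l, ‖(∫ z, fourierFeature z (w j - w l) ∂μ) -
      (1 / (m : ℂ)) * ∑ k, fourierFeature (x k) (w j - w l)‖ ≤ Δ) :
    ∫ z, ‖prunedExpansion w c Finset.univ z‖ ^ 2 ∂μ ≤
      (1 / (m : ℝ)) * ∑ k, ‖prunedExpansion w c Finset.univ (x k)‖ ^ 2 + l1Norm c ^ 2 * Δ := by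
  have h1 : (((1 / (m : ℝ)) * ∑ k, ‖prunedExpansion w c Finset.univ (x k)‖ ^ 2 : ℝ) : ℂ) =
      ∑ j, ∑ l, c j * (starRingEnd ℂ) (c l) *
        ((1 / (m : ℂ)) * ∑ k, fourierFeature (x k) (w j - w l)) := by
    rw [Complex.ofReal_mul, Complex.ofReal_sum]
    simp_rw [norm_sq_prunedExpansion]
    rw [Finset.sum_comm, Finset.mul_sum]
    refine Finset.sum_congr rfl fun j _ => ?_
    rw [Finset.sum_comm, Finset.mul_sum]
    refine Finset.sum_congr rfl fun l _ => ?_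
    rw [← Finset.mul_sum]
    push_cast
    ring
  have h2 := integral_norm_sq_prunedExpansion μ w c
  have h3 : ‖((∫ z, ‖prunedExpansion w c Finset.univ z‖ ^ 2 ∂μ : ℝ) : ℂ) -
      (((1 / (m : ℝ)) * ∑ k, ‖prunedExpansion w c Finset.univ (x k)‖ ^ 2 : ℝ) : ℂ)‖ ≤
      l1Norm c ^ 2 * Δ := by
    rw [h1, h2, ← Finset.sum_sub_distrib, sq, l1Norm, Finset.sum_mul_sum, Finset.sum_mul]
    refine norm_sum_le_of_le _ fun j _ => ?_
    rw [← Finset.sum_sub_distrib, Finset.sum_mul]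
    refine norm_sum_le_of_le _ fun l _ => ?_
    rw [← mul_sub, norm_mul, norm_mul, RCLike.norm_conj]
    gcongr
    exact hΔ j l
  rw [← Complex.ofReal_sub, Complex.norm_real] at h3
  linarith [le_abs_self ((∫ z, ‖prunedExpansion w c Finset.univ z‖ ^ 2 ∂μ) -
    (1 / (m : ℝ)) * ∑ k, ‖prunedExpansion w c Finset.univ (x k)‖ ^ 2), h3,
    Real.norm_eq_abs ((∫ z, ‖prunedExpansion w c Finset.univ z‖ ^ 2 ∂μ) -
    (1 / (m : ℝ)) * ∑ k, ‖prunedExpansion w c Finset.univ (x k)‖ ^ 2)]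

/-- A Schur-type bound for the Gram matrix of the features in `L²(N(0, γ² I))`. -/
lemma integral_norm_sq_prunedExpansion_le_rowSum {N : ℕ} {γ : ℝ} (hγ : 0 < γ)
    (w : Fin N → EuclideanSpace ℝ (Fin d)) (c : Fin N → ℂ) {b K : ℝ} (hb : ∀ j, ‖c j‖ ≤ b)
    (hb0 : 0 ≤ b) (hK : ∀ j, ∑ l, Real.exp (-(γ ^ 2 * ‖w l - w j‖ ^ 2 / 2)) ≤ K) :
    ∫ z, ‖prunedExpansion w c Finset.univ z‖ ^ 2 ∂(sphericalGaussian d γ) ≤ l1Norm c * (b * K) := by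
  have := isProbabilityMeasure_sphericalGaussian d hγ
  have h2 := integral_norm_sq_prunedExpansion (sphericalGaussian d γ) w c
  have h3 : ‖((∫ z, ‖prunedExpansion w c Finset.univ z‖ ^ 2 ∂(sphericalGaussian d γ) : ℝ) : ℂ)‖ ≤
      l1Norm c * (b * K) := by
    rw [h2, l1Norm, Finset.sum_mul]
    refine norm_sum_le_of_le _ fun j _ => ?_
    calc ‖∑ l, c j * (starRingEnd ℂ) (c l) *
          ∫ x, fourierFeature x (w j - w l) ∂(sphericalGaussian d γ)‖
        ≤ ∑ l, ‖c j‖ * (b * Real.exp (-(γ ^ 2 * ‖w l - w j‖ ^ 2 / 2))) := by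
          refine norm_sum_le_of_le _ fun l _ => ?_
          rw [integral_fourierFeature hγ, norm_mul, norm_mul, RCLike.norm_conj, Complex.norm_real,
            Real.norm_eq_abs, abs_of_pos (Real.exp_pos _), norm_sub_rev (w j) (w l), mul_assoc]
          gcongr
          exact hb l
      _ = ‖c j‖ * (b * ∑ l, Real.exp (-(γ ^ 2 * ‖w l - w j‖ ^ 2 / 2))) := by
          rw [← Finset.mul_sum, ← Finset.mul_sum]
      _ ≤ ‖c j‖ * (b * K) := by gcongr; exact hK j
  rw [Complex.norm_real] at h3
  exact (le_abs_self _).trans h3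

end Features

/-! ### Sparse approximation and existence of basis pursuit solutions -/

section SparseApproximation

variable {N : ℕ}

lemma l1Norm_nonneg (c : Fin N → ℂ) : 0 ≤ l1Norm c := Finset.sum_nonneg fun _ _ => norm_nonneg _

lemma l1Norm_sub_le (a b : Fin N → ℂ) : l1Norm (a - b) ≤ l1Norm a + l1Norm b := by
  rw [l1Norm, l1Norm, l1Norm, ← Finset.sum_add_distrib]
  exact Finset.sum_le_sum fun j _ => norm_sub_le _ _

lemma l1Norm_smul (t : ℝ) (c : Fin N → ℂ) : l1Norm ((t : ℂ) • c) = |t| * l1Norm c := by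
  simp [l1Norm, Finset.mul_sum]

lemma l2Norm_eq_norm (c : Fin N → ℂ) : l2Norm c = ‖WithLp.toLp 2 c‖ := by
  rw [EuclideanSpace.norm_eq]; rfl

lemma l2Norm_sub_le (a b : Fin N → ℂ) : l2Norm (a - b) ≤ l2Norm a + l2Norm b := by
  simp only [l2Norm_eq_norm, WithLp.toLp_sub]
  exact norm_sub_le _ _

lemma kappaOne_nonneg (s : ℕ) (c : Fin N → ℂ) : 0 ≤ kappaOne s c := by
  refine Real.sInf_nonneg ?_
  rintro _ ⟨z, _, rfl⟩
  exact l1Norm_nonneg _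

/-- Split along the support of any sparse competitor: on it the sup bound applies, off it the
competitor's error already contains the entries of `c`. -/
lemma l1Norm_le_kappaOne_add (s : ℕ) (c : Fin N → ℂ) {b : ℝ} (hb0 : 0 ≤ b)
    (hb : ∀ j, ‖c j‖ ≤ b) : l1Norm c ≤ kappaOne s c + (min s N : ℕ) * b := by
  rw [← sub_le_iff_le_add]
  refine le_csInf ⟨_, 0, by simp [IsSparse], rfl⟩ ?_
  rintro _ ⟨z, hz, rfl⟩
  classical
  set T : Finset (Fin N) := Finset.univ.filter fun j => z j ≠ 0 with hT
  have hcard : T.card ≤ min s N := by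
    refine le_min ?_ (by simpa using Finset.card_le_univ T)
    have : Function.support z = (T : Set (Fin N)) := by ext j; simp [hT]
    rwa [IsSparse, this, Set.ncard_coe_finset] at hz
  have h1 : ∑ j ∈ T, ‖c j‖ ≤ (min s N : ℕ) * b := by
    refine (Finset.sum_le_sum fun j _ => hb j).trans ?_
    rw [Finset.sum_const, nsmul_eq_mul]
    gcongr
  have h2 : ∑ j ∈ Tᶜ, ‖c j‖ ≤ l1Norm (c - z) := by
    refine le_trans (Finset.sum_le_sum fun j hj => ?_)
      (Finset.sum_le_sum_of_subset_of_nonneg (Finset.subset_univ Tᶜ) fun _ _ _ => norm_nonneg _)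
    have : z j = 0 := by simpa [hT] using hj
    simp [this]
  have h3 : l1Norm c = ∑ j ∈ T, ‖c j‖ + ∑ j ∈ Tᶜ, ‖c j‖ := (Finset.sum_add_sum_compl T _).symm
  linarith

/-- Basis pursuit has a solution as soon as it is feasible. -/
lemma exists_isBasisPursuitSolution {m : ℕ} (A : Matrix (Fin m) (Fin N) ℂ) (y : Fin m → ℂ) {η : ℝ}
    {c₀ : Fin N → ℂ} (h₀ : l2Norm (A.mulVec c₀ - y) ≤ η * Real.sqrt m) :
    ∃ c, IsBasisPursuitSolution A y η c := by
  have hl1 : Continuous (l1Norm : (Fin N → ℂ) → ℝ) := by unfold l1Norm; fun_prop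
  have hl2 : Continuous fun c : Fin N → ℂ => l2Norm (A.mulVec c - y) := by
    unfold l2Norm Matrix.mulVec dotProduct
    simp only [Pi.sub_apply]
    fun_prop
  -- Only feasible points no worse than `c₀` matter, and these form a compact set.
  set K : Set (Fin N → ℂ) :=
    {c | l2Norm (A.mulVec c - y) ≤ η * Real.sqrt m} ∩ {c | l1Norm c ≤ l1Norm c₀} with hK
  have hKc : IsCompact K := by
    refine Metric.isCompact_of_isClosed_isBounded
      ((isClosed_le hl2 continuous_const).inter (isClosed_le hl1 continuous_const)) ?_
    refine (Metric.isBounded_closedBall (x := (0 : Fin N → ℂ)) (r := l1Norm c₀)).subset ?_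
    rintro c ⟨_, hc⟩
    rw [mem_closedBall_zero_iff, pi_norm_le_iff_of_nonneg (l1Norm_nonneg _)]
    intro j
    exact (Finset.single_le_sum (f := fun j => ‖c j‖) (fun _ _ => norm_nonneg _)
      (Finset.mem_univ j)).trans hc
  obtain ⟨c, hcK, hmin⟩ := hKc.exists_isMinOn ⟨c₀, h₀, le_refl (l1Norm c₀)⟩ hl1.continuousOn
  refine ⟨c, hcK.1, fun c' hc' => ?_⟩
  by_cases h : l1Norm c' ≤ l1Norm c₀
  · exact hmin ⟨hc', h⟩
  · exact hcK.2.trans (not_le.1 h).le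

/-- A discarded entry is dominated by each of the `s` retained ones. -/
lemma IsLargestIndexSet.mul_norm_le {s : ℕ} (hs : s ≤ N) {c : Fin N → ℂ} {S : Finset (Fin N)}
    (hS : IsLargestIndexSet s c S) {l : Fin N} (hl : l ∉ S) : s * ‖c l‖ ≤ l1Norm c := by
  have h1 : ∑ _j ∈ S, ‖c l‖ ≤ ∑ j ∈ S, ‖c j‖ := Finset.sum_le_sum fun j hj => hS.2 j hj l hl
  rw [Finset.sum_const, hS.1, min_eq_left hs, nsmul_eq_mul] at h1
  exact h1.trans (Finset.sum_le_sum_of_subset_of_nonneg (Finset.subset_univ _)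
    fun _ _ _ => norm_nonneg _)

lemma norm_cStar_le {d : ℕ} {ρ : EuclideanSpace ℝ (Fin d) → ℝ} {α : EuclideanSpace ℝ (Fin d) → ℂ}
    (hα : BddAbove (Set.range fun ω => ‖α ω / (ρ ω : ℂ)‖))
    (w : Fin N → EuclideanSpace ℝ (Fin d)) (j : Fin N) :
    ‖cStar ρ α w j‖ ≤ rhoNorm ρ α / N := by
  rw [cStar, norm_mul, div_eq_inv_mul (rhoNorm ρ α)]
  gcongr
  · simp
  · exact le_ciSup hα (w j)

end SparseApproximation

/-! ### Deterministic error bound -/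

section Pruning

variable {d N : ℕ}

lemma prunedExpansion_add (w : Fin N → EuclideanSpace ℝ (Fin d)) (a b : Fin N → ℂ)
    (S : Finset (Fin N)) (x : EuclideanSpace ℝ (Fin d)) :
    prunedExpansion w (a + b) S x = prunedExpansion w a S x + prunedExpansion w b S x := by
  simp [prunedExpansion, add_mul, Finset.sum_add_distrib]

lemma prunedExpansion_sub (w : Fin N → EuclideanSpace ℝ (Fin d)) (a b : Fin N → ℂ)
    (S : Finset (Fin N)) (x : EuclideanSpace ℝ (Fin d)) :
    prunedExpansion w (a - b) S x = prunedExpansion w a S x - prunedExpansion w b S x := by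
  simp [prunedExpansion, sub_mul, Finset.sum_sub_distrib]

/-- The `L²` size of an expansion whose coefficients have `ℓ¹` norm at most `κ + s b` and sup norm
at most `(κ + s b) / s`. -/
lemma sqrt_integral_norm_sq_spread_le {γ : ℝ} (hγ : 0 < γ) (w : Fin N → EuclideanSpace ℝ (Fin d))
    (v : Fin N → ℂ) {s : ℕ} (hs : 1 ≤ s) {κ b K : ℝ} (hκ : 0 ≤ κ) (hb : 0 ≤ b) (hK0 : 0 ≤ K)
    (h1 : l1Norm v ≤ κ + s * b) (hinf : ∀ j, s * ‖v j‖ ≤ κ + s * b)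
    (hK : ∀ j, ∑ l, Real.exp (-(γ ^ 2 * ‖w l - w j‖ ^ 2 / 2)) ≤ K) :
    Real.sqrt (∫ z, ‖prunedExpansion w v Finset.univ z‖ ^ 2 ∂(sphericalGaussian d γ)) ≤
      κ + b * Real.sqrt (s * K) := by
  have hprob := isProbabilityMeasure_sphericalGaussian d hγ
  have hs0 : (0 : ℝ) < s := by exact_mod_cast hs
  have ht : 0 ≤ κ + s * b := by positivity
  rcases ht.eq_or_lt with h0 | hpos
  · have hv : ∀ j, v j = 0 := fun j => by
      have := hinf j
      rw [← h0] at this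
      have h2 : ‖v j‖ ≤ 0 := by
        by_contra hc
        have := mul_pos hs0 (not_le.1 hc)
        linarith
      simpa using h2
    have : ∀ z, prunedExpansion w v Finset.univ z = 0 := fun z => by simp [prunedExpansion, hv]
    simp only [this, norm_zero]
    simp
    positivity
  -- The vector is divided proportionally: `θ v` has `ℓ¹` norm at most `κ` and is bounded pointwise,
  -- while `(1 - θ) v` has `ℓ¹` norm at most `s b` and sup norm at most `b`, as the Schur bound
  -- requires.
  set θ : ℝ := κ / (κ + s * b) with hθ
  have hθ0 : 0 ≤ θ := by positivity
  have hθ1 : 1 - θ = s * b / (κ + s * b) := by rw [hθ]; field_simp; ring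
  have hθ2 : 0 ≤ 1 - θ := by rw [hθ1]; positivity
  have hsplit : v = (θ : ℂ) • v + ((1 - θ : ℝ) : ℂ) • v := by
    rw [← add_smul]; push_cast; simp
  have hθv : l1Norm ((θ : ℂ) • v) ≤ κ := by
    rw [l1Norm_smul, abs_of_nonneg hθ0]
    calc θ * l1Norm v ≤ θ * (κ + s * b) := by gcongr
      _ = κ := by rw [hθ]; field_simp
  have hθv' : l1Norm (((1 - θ : ℝ) : ℂ) • v) ≤ s * b := by
    rw [l1Norm_smul, abs_of_nonneg hθ2]
    calc (1 - θ) * l1Norm v ≤ (1 - θ) * (κ + s * b) := by gcongr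
      _ = s * b := by rw [hθ1]; field_simp
  have hinf' : ∀ j, ‖(((1 - θ : ℝ) : ℂ) • v) j‖ ≤ b := by
    intro j
    rw [Pi.smul_apply, smul_eq_mul, norm_mul, Complex.norm_real, Real.norm_eq_abs,
      abs_of_nonneg hθ2]
    refine le_of_mul_le_mul_left ?_ hs0
    calc s * ((1 - θ) * ‖v j‖) = (1 - θ) * (s * ‖v j‖) := by ring
      _ ≤ (1 - θ) * (κ + s * b) := by gcongr; exact hinf j
      _ = s * b := by rw [hθ1]; field_simp
  have htri := sqrt_integral_norm_sq_add_le (μ := sphericalGaussian d γ)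
    (memLp_prunedExpansion _ w ((θ : ℂ) • v) Finset.univ)
    (memLp_prunedExpansion _ w (((1 - θ : ℝ) : ℂ) • v) Finset.univ)
  simp_rw [← prunedExpansion_add, ← hsplit] at htri
  refine htri.trans (add_le_add ?_ ?_)
  · exact sqrt_integral_norm_sq_le hκ fun z => (norm_prunedExpansion_le _ _ _ _).trans hθv
  · refine Real.sqrt_le_iff.2 ⟨by positivity, ?_⟩
    refine (integral_norm_sq_prunedExpansion_le_rowSum hγ w _ hinf' hb hK).trans ?_
    rw [mul_pow, Real.sq_sqrt (by positivity)]
    calc l1Norm (((1 - θ : ℝ) : ℂ) • v) * (b * K) ≤ (s * b) * (b * K) := by gcongr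
      _ = b ^ 2 * (s * K) := by ring

/-- The deterministic error bound for pruned basis pursuit solutions. -/
theorem l2Error_prunedExpansion_le {m : ℕ} (hm : 0 < m) {γ : ℝ} (hγ : 0 < γ)
    {f : EuclideanSpace ℝ (Fin d) → ℂ}
    (hf : MemLp f 2 (sphericalGaussian d γ)) (x : Fin m → EuclideanSpace ℝ (Fin d))
    (w : Fin N → EuclideanSpace ℝ (Fin d)) {y : Fin m → ℂ} {c₀ c : Fin N → ℂ}
    {s : ℕ} (hs : 1 ≤ s) {S : Finset (Fin N)} {β η b Δ K : ℝ} (hη : 0 ≤ η) (hb : 0 ≤ b)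
    (hΔ0 : 0 ≤ Δ) (hK0 : 0 ≤ K) (hc₀ : ∀ j, ‖c₀ j‖ ≤ b)
    (hβ : l2Error (sphericalGaussian d γ) f (prunedExpansion w c₀ Finset.univ) ≤ β)
    (hfeas : l2Norm ((featureMatrix x w).mulVec c₀ - y) ≤ η * Real.sqrt m)
    (hΔ : ∀ j l, ‖(∫ z, fourierFeature z (w j - w l) ∂(sphericalGaussian d γ)) -
      (1 / (m : ℂ)) * ∑ k, fourierFeature (x k) (w j - w l)‖ ≤ Δ)
    (hK : ∀ j, ∑ l, Real.exp (-(γ ^ 2 * ‖w l - w j‖ ^ 2 / 2)) ≤ K)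
    (hc : IsBasisPursuitSolution (featureMatrix x w) y η c) (hS : IsLargestIndexSet s c S) :
    l2Error (sphericalGaussian d γ) f (prunedExpansion w c S) ≤
      β + (2 * η + 2 * (kappaOne s c₀ + (min s N : ℕ) * b) * Real.sqrt Δ) +
        (if s < N then kappaOne s c₀ + b * Real.sqrt (s * K) else 0) := by
  have hprob := isProbabilityMeasure_sphericalGaussian d hγ
  have hm0 : (0 : ℝ) < m := by exact_mod_cast hm
  set μ := sphericalGaussian d γ with hμ
  set κ := kappaOne s c₀ with hκdef
  have hκ : 0 ≤ κ := kappaOne_nonneg _ _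
  have hl0 : l1Norm c₀ ≤ κ + (min s N : ℕ) * b := l1Norm_le_kappaOne_add s c₀ hb hc₀
  have hl : l1Norm c ≤ κ + (min s N : ℕ) * b := (hc.2 c₀ hfeas).trans hl0
  have hmul : ∀ a : Fin N → ℂ, ∀ k, (featureMatrix x w).mulVec a k =
      prunedExpansion w a Finset.univ (x k) := by
    intro a k
    simp [Matrix.mulVec, dotProduct, featureMatrix, prunedExpansion, mul_comm]
  have hfit : Real.sqrt (∫ z, ‖prunedExpansion w (c₀ - c) Finset.univ z‖ ^ 2 ∂μ) ≤
      2 * η + 2 * (κ + (min s N : ℕ) * b) * Real.sqrt Δ := by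
    have h1 := integral_norm_sq_prunedExpansion_le μ x w (c₀ - c) hΔ
    have h2 : l2Norm ((featureMatrix x w).mulVec (c₀ - c)) ≤ 2 * η * Real.sqrt m := by
      have := l2Norm_sub_le ((featureMatrix x w).mulVec c₀ - y) ((featureMatrix x w).mulVec c - y)
      rw [sub_sub_sub_cancel_right, ← Matrix.mulVec_sub] at this
      linarith [hc.1]
    have h3 : (1 / (m : ℝ)) * ∑ k, ‖prunedExpansion w (c₀ - c) Finset.univ (x k)‖ ^ 2 ≤
        (2 * η) ^ 2 := by
      have h4 : l2Norm ((featureMatrix x w).mulVec (c₀ - c)) ^ 2 ≤ (2 * η * Real.sqrt m) ^ 2 :=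
        pow_le_pow_left₀ (Real.sqrt_nonneg _) h2 2
      rw [l2Norm, Real.sq_sqrt (Finset.sum_nonneg fun _ _ => by positivity), mul_pow,
        Real.sq_sqrt hm0.le] at h4
      simp only [hmul] at h4
      rw [one_div, inv_mul_le_iff₀ hm0]
      linarith
    have h5 : l1Norm (c₀ - c) ≤ 2 * (κ + (min s N : ℕ) * b) := by
      linarith [l1Norm_sub_le c₀ c]
    refine Real.sqrt_le_iff.2 ⟨by positivity, h1.trans ?_⟩
    have h6 : l1Norm (c₀ - c) ^ 2 * Δ ≤ (2 * (κ + (min s N : ℕ) * b) * Real.sqrt Δ) ^ 2 := by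
      rw [mul_pow _ (Real.sqrt Δ), Real.sq_sqrt hΔ0]
      gcongr
      exact l1Norm_nonneg _
    -- The cross term that turns a sum of squares into the square of a sum.
    have h7 : 0 ≤ 2 * (2 * η) * (2 * (κ + (min s N : ℕ) * b) * Real.sqrt Δ) := by positivity
    nlinarith
  have hprune : Real.sqrt (∫ z, ‖prunedExpansion w (fun j => if j ∈ S then 0 else c j)
      Finset.univ z‖ ^ 2 ∂μ) ≤ if s < N then κ + b * Real.sqrt (s * K) else 0 := by
    split_ifs with hsN
    · have hmin : min s N = s := min_eq_left hsN.le
      rw [hmin] at hl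
      refine sqrt_integral_norm_sq_spread_le hγ w _ hs hκ hb hK0 (le_trans ?_ hl) (fun j => ?_) hK
      · refine Finset.sum_le_sum fun j _ => ?_
        dsimp only
        split_ifs <;> simp
      · split_ifs with hj
        · simp; positivity
        · exact (hS.mul_norm_le hsN.le hj).trans hl
    · have hSu : S = Finset.univ := by
        rw [← Finset.card_eq_iff_eq_univ, hS.1, min_eq_right (not_lt.1 hsN), Fintype.card_fin]
      simp [hSu, prunedExpansion]
  -- Three errors: discretization by `c₀`, disagreement of `c₀` with the full solution, and the
  -- discarded coefficients.
  have hdec : ∀ z, f z - prunedExpansion w c S z =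
      (f z - prunedExpansion w c₀ Finset.univ z) + (prunedExpansion w (c₀ - c) Finset.univ z +
        prunedExpansion w (fun j => if j ∈ S then 0 else c j) Finset.univ z) := by
    intro z
    have : prunedExpansion w c Finset.univ z = prunedExpansion w c S z +
        prunedExpansion w (fun j => if j ∈ S then 0 else c j) Finset.univ z := by
      unfold prunedExpansion
      rw [← Finset.sum_add_sum_compl S, add_right_inj,
        ← Finset.sum_add_sum_compl S (fun j => (if j ∈ S then 0 else c j) * fourierFeature z (w j))]
      rw [Finset.sum_eq_zero (s := S), zero_add]
      · refine Finset.sum_congr rfl fun j hj => ?_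
        simp [Finset.mem_compl.1 hj]
      · intro j hj; simp [hj]
    rw [prunedExpansion_sub, this]
    ring
  unfold l2Error at hβ ⊢
  simp_rw [hdec]
  refine (sqrt_integral_norm_sq_add_le (hf.sub (memLp_prunedExpansion μ w c₀ _))
    ((memLp_prunedExpansion μ w _ _).add (memLp_prunedExpansion μ w _ _))).trans ?_
  have h8 := sqrt_integral_norm_sq_add_le (memLp_prunedExpansion μ w (c₀ - c) Finset.univ)
    (memLp_prunedExpansion μ w (fun j => if j ∈ S then 0 else c j) Finset.univ)
  simp only [Pi.sub_apply, Pi.add_apply]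
  linarith

end Pruning

/-! ### Consequences of the parameter conditions -/

section Parameters

/-- Since `√41 ≥ 6` and `2s - 1 ≥ s`, the base in the bandwidth condition is at least `3s`; raising
to the power `d/2` undoes the exponent `2/d`. -/
lemma three_mul_le_of_bandwidth {d s : ℕ} (hd : 0 < d) (hs : 1 ≤ s) {R2 : ℝ}
    (h : R2 ≥ 1 / 2 * ((Real.sqrt 41 * (2 * (s : ℝ) - 1) / 2) ^ ((2 : ℝ) / (d : ℝ)) - 1)) :
    3 * (s : ℝ) ≤ (2 * R2 + 1) ^ ((d : ℝ) / 2) := by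
  have hd' : (0 : ℝ) < d := by exact_mod_cast hd
  have hs' : (1 : ℝ) ≤ s := by exact_mod_cast hs
  have h41 : (6 : ℝ) ≤ Real.sqrt 41 := Real.le_sqrt_of_sq_le (by norm_num)
  set B : ℝ := Real.sqrt 41 * (2 * (s : ℝ) - 1) / 2 with hB
  have hB3 : 3 * (s : ℝ) ≤ B := by rw [hB]; nlinarith
  have hB0 : 0 ≤ B := by linarith
  have h1 : B ^ ((2 : ℝ) / (d : ℝ)) ≤ 2 * R2 + 1 := by linarith
  have h2 := Real.rpow_le_rpow (by positivity) h1 (by positivity : 0 ≤ (d : ℝ) / 2)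
  rw [← Real.rpow_mul hB0] at h2
  have h3 : (2 : ℝ) / d * (d / 2) = 1 := by field_simp
  rw [h3, Real.rpow_one] at h2
  linarith

/-- The numerator is at most `3√a` and `√m ≥ 2q√a`, leaving `3/(2q) ≤ 1/(2s)`. -/
lemma deviation_le {s m : ℕ} (hs : 1 ≤ s) {q a : ℝ} (hq : 3 * (s : ℝ) ≤ q) (ha : 1 ≤ a)
    (hm : 4 * q ^ 2 * a ≤ m) : 1 / Real.sqrt m * (1 + Real.sqrt (2 * a)) ≤ 1 / (2 * s) := by
  have hs' : (1 : ℝ) ≤ s := by exact_mod_cast hs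
  have hsa : 1 ≤ Real.sqrt a := Real.one_le_sqrt.2 ha
  have h1 : 2 * q * Real.sqrt a ≤ Real.sqrt m := by
    refine Real.le_sqrt_of_sq_le ?_
    rw [mul_pow, Real.sq_sqrt (by linarith)]
    linarith
  have h2 : Real.sqrt (2 * a) ≤ 2 * Real.sqrt a := by
    rw [Real.sqrt_mul (by norm_num)]
    gcongr
    rw [Real.sqrt_le_left (by norm_num)]; norm_num
  have h3 : 0 < 2 * q * Real.sqrt a := by
    have : 0 < q := by linarith
    positivity
  rw [one_div_mul_eq_div, div_le_div_iff₀ (h3.trans_le h1) (by linarith)]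
  have h4 : 3 * (s : ℝ) * Real.sqrt a ≤ q * Real.sqrt a := by gcongr
  nlinarith

/-- With `u`, `v` the last two summands of the squared bracket, `ε√N = 2(1 + u + v)`. The first
bound serves the Monte Carlo error, the second the row sums; of the nested root only the lower bound
`1` is used. -/
lemma le_sample_size {d N : ℕ} {γ σ ε D L : ℝ} (hε : 0 < ε) (hγσ : 0 ≤ γ * σ)
    (hN : (N : ℝ) = 4 / ε ^ 2 * (1 + 4 * γ * σ * d * Real.sqrt (1 + Real.sqrt D) +
      Real.sqrt (1 / 2 * L)) ^ 2) (hL : 0 ≤ L) :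
    2 + Real.sqrt (2 * L) ≤ ε * Real.sqrt N ∧
      2 * (2 + d * (γ ^ 2 * σ ^ 2) + L) ≤ ε ^ 2 * N := by
  set v := Real.sqrt (1 / 2 * L) with hv
  set u := 4 * γ * σ * d * Real.sqrt (1 + Real.sqrt D) with hu
  have hv0 : 0 ≤ v := Real.sqrt_nonneg _
  have hv2 : v ^ 2 = L / 2 := by rw [hv, Real.sq_sqrt (by positivity)]; ring
  have h0 : 0 ≤ 4 * γ * σ * d := by
    have : 4 * γ * σ * d = 4 * (γ * σ) * d := by ring
    rw [this]; positivity
  have hu1 : 4 * γ * σ * d ≤ u :=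
    le_mul_of_one_le_right h0 (Real.one_le_sqrt.2 (by linarith [Real.sqrt_nonneg D]))
  have hu0 : 0 ≤ u := h0.trans hu1
  have hN2 : ε ^ 2 * N = 4 * (1 + u + v) ^ 2 := by rw [hN]; field_simp
  have hsq : ε * Real.sqrt N = 2 * (1 + u + v) := by
    have : (ε * Real.sqrt N) ^ 2 = (2 * (1 + u + v)) ^ 2 := by
      rw [mul_pow, Real.sq_sqrt (Nat.cast_nonneg _), hN2]; ring
    exact (pow_left_inj₀ (by positivity) (by positivity) (by norm_num)).1 this
  have hv' : Real.sqrt (2 * L) = 2 * v := by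
    rw [hv, show 2 * L = 2 ^ 2 * (1 / 2 * L) by ring, Real.sqrt_mul (by norm_num),
      Real.sqrt_sq (by norm_num)]
  refine ⟨by rw [hsq, hv']; linarith, ?_⟩
  have hu2 : (4 * γ * σ * d) ^ 2 ≤ u ^ 2 := pow_le_pow_left₀ h0 hu1 2
  have hdd : (d : ℝ) ≤ (d : ℝ) ^ 2 := by
    rcases Nat.eq_zero_or_pos d with h | h
    · simp [h]
    · have : (1 : ℝ) ≤ d := by exact_mod_cast h
      nlinarith
  have h5 : d * (γ ^ 2 * σ ^ 2) ≤ (d : ℝ) ^ 2 * (γ ^ 2 * σ ^ 2) := by gcongr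
  have h6 : 0 ≤ (d : ℝ) * (γ ^ 2 * σ ^ 2) := by positivity
  rw [hN2]
  nlinarith [mul_nonneg hu0 hv0]

/-- The bandwidth condition makes `s` times the mean kernel value at most `2^(d/2)`, and gives `log
s ≤ d R2`. Together with `s log(N/s) ≤ N`, this bounds the radicand by `N` times a quantity that
`ε²N` controls. -/
lemma sqrt_rowSum_le {d s N : ℕ} (hs : 1 ≤ s) (hsN : s < N) {R2 ε δ : ℝ} (hR : 0 ≤ R2) (hε : 0 < ε)
    (hδ : 0 < δ) (hδ1 : δ < 1) (hq : 3 * (s : ℝ) ≤ (2 * R2 + 1) ^ ((d : ℝ) / 2))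
    (hN : 2 * (2 + d * R2 + Real.log (1 / δ)) ≤ ε ^ 2 * N) :
    Real.sqrt (s * (1 + 2 * N * (1 + R2) ^ (-((d : ℝ) / 2)) + Real.log (N / δ))) ≤
      ε * N * (1 + 2 ^ ((d : ℝ) / 2)) := by
  have hs' : (1 : ℝ) ≤ s := by exact_mod_cast hs
  have hsN' : (s : ℝ) ≤ N := by exact_mod_cast hsN.le
  have hN0 : (0 : ℝ) < N := by linarith
  have hs0 : (0 : ℝ) < s := by linarith
  set L := Real.log (1 / δ) with hL
  have hL0 : 0 ≤ L := Real.log_nonneg (by rw [le_div_iff₀ hδ]; linarith)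
  set t : ℝ := 2 ^ ((d : ℝ) / 2) with ht
  set p : ℝ := (1 + R2) ^ (-((d : ℝ) / 2)) with hp
  have ht0 : 0 < t := by positivity
  have hsp : s * p ≤ t := by
    have h1 : (2 * R2 + 1) ^ ((d : ℝ) / 2) ≤ t * (1 + R2) ^ ((d : ℝ) / 2) := by
      rw [ht, ← Real.mul_rpow (by norm_num) (by positivity)]
      exact Real.rpow_le_rpow (by positivity) (by linarith) (by positivity)
    have h2 : (s : ℝ) ≤ t * (1 + R2) ^ ((d : ℝ) / 2) := by linarith
    rw [hp, Real.rpow_neg (by positivity), ← div_eq_mul_inv, div_le_iff₀ (by positivity)]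
    exact h2
  have hlogs : Real.log s ≤ d * R2 := by
    have h1 : Real.log s ≤ Real.log ((2 * R2 + 1) ^ ((d : ℝ) / 2)) :=
      Real.log_le_log hs0 (by linarith)
    rw [Real.log_rpow (by positivity)] at h1
    have h2 : Real.log (2 * R2 + 1) ≤ 2 * R2 := by
      linarith [Real.log_le_sub_one_of_pos (by positivity : 0 < 2 * R2 + 1)]
    have h3 : (d : ℝ) / 2 * Real.log (2 * R2 + 1) ≤ (d : ℝ) / 2 * (2 * R2) := by gcongr
    linarith
  have hlog : s * Real.log (N / δ) ≤ N * (1 + d * R2 + L) := by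
    have h1 : Real.log (N / δ) = Real.log (N / s) + Real.log s + L := by
      rw [hL, Real.log_div hN0.ne' hδ.ne', Real.log_div hN0.ne' hs0.ne',
        Real.log_div one_ne_zero hδ.ne', Real.log_one]
      ring
    have h2 : s * Real.log (N / s) ≤ N := by
      have := Real.log_le_sub_one_of_pos (by positivity : 0 < (N : ℝ) / s)
      calc s * Real.log (N / s) ≤ s * (N / s) := by gcongr; linarith
        _ = N := by field_simp
    have h3 : s * (Real.log s + L) ≤ N * (d * R2 + L) := by
      have : 0 ≤ Real.log s := Real.log_nonneg hs'
      gcongr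
    rw [h1]
    nlinarith
  refine Real.sqrt_le_iff.2 ⟨by positivity, ?_⟩
  have h1 : s * (1 + 2 * N * p + Real.log (N / δ)) ≤ N * (2 + d * R2 + L + 2 * t) := by
    have : N * (s * p) ≤ N * t := by gcongr
    nlinarith
  have h2 : 2 + d * R2 + L + 2 * t ≤ ε ^ 2 * N * (1 + t) ^ 2 := by
    have h3 : 0 ≤ (d : ℝ) * R2 := by positivity
    have h4 : 2 ≤ ε ^ 2 * N := by linarith
    have h5 : ε ^ 2 * N * (1 + 2 * t) ≤ ε ^ 2 * N * (1 + t) ^ 2 := by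
      gcongr; nlinarith
    nlinarith
  calc s * (1 + 2 * N * p + Real.log (N / δ)) ≤ N * (2 + d * R2 + L + 2 * t) := h1
    _ ≤ N * (ε ^ 2 * N * (1 + t) ^ 2) := by gcongr
    _ = (ε * N * (1 + t)) ^ 2 := by ring

end Parameters

/-! ### Probabilistic preparation -/

section Events

lemma prod_le_of_forall_left {X Y : Type*} [MeasurableSpace X] [MeasurableSpace Y]
    (μ : Measure X) [IsProbabilityMeasure μ] (ν : Measure Y) [IsProbabilityMeasure ν]
    {A : Set (X × Y)} (hA : MeasurableSet A) {c : ENNReal}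
    (h : ∀ x, ν {y | (x, y) ∈ A} ≤ c) : (μ.prod ν) A ≤ c := by
  rw [Measure.prod_apply hA]
  exact (lintegral_mono h).trans (by simp)

lemma prod_le_of_forall_right {X Y : Type*} [MeasurableSpace X] [MeasurableSpace Y]
    (μ : Measure X) [IsProbabilityMeasure μ] (ν : Measure Y) [IsProbabilityMeasure ν]
    {A : Set (X × Y)} (hA : MeasurableSet A) {c : ENNReal}
    (h : ∀ y, μ {x | (x, y) ∈ A} ≤ c) : (μ.prod ν) A ≤ c := by
  rw [Measure.prod_apply_symm hA]
  exact (lintegral_mono h).trans (by simp)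

lemma measure_empiricalMean_gt_le {W X : Type*} [MeasurableSpace W] [MeasurableSpace X]
    (ρ : Measure W) [IsProbabilityMeasure ρ] (Q : Measure X)
    [IsProbabilityMeasure Q] {n : ℕ} (hn : 0 < n) {T : W → X → ℂ}
    (hT : Measurable (Function.uncurry T)) {B : ℝ} (hB0 : 0 ≤ B) (hB : ∀ w x, ‖T w x‖ ≤ B) {a : ℝ}
    (ha : 0 ≤ a) {θ : ℝ} (hθ : B / Real.sqrt n * (1 + Real.sqrt (2 * a)) ≤ θ) :
    (Measure.pi fun _ : Fin n => ρ)
      {w | θ < Real.sqrt (∫ x, ‖(∫ b, T b x ∂ρ) - (1 / (n : ℂ)) * ∑ j, T (w j) x‖ ^ 2 ∂Q)} ≤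
      ENNReal.ofReal (Real.exp (-a)) := by
  rcases hB0.eq_or_lt with h0 | hpos
  · have hT0 : ∀ w x, T w x = 0 := fun w x => by simpa [← h0] using hB w x
    have hθ0 : ¬ θ < 0 := by
      rw [← h0] at hθ
      simp only [zero_div, zero_mul] at hθ
      exact not_lt.2 hθ
    simp [hT0, hθ0]
  · rw [← ENNReal.ofReal_toReal (measure_ne_top (Measure.pi fun _ : Fin n => ρ) _)]
    refine ENNReal.ofReal_le_ofReal ?_
    refine le_trans (measureReal_mono ?_) (measure_empiricalMean_ge_le ρ Q hn hT hpos hB ha)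
    intro w hw
    exact hθ.trans (le_of_lt hw)

/-- The uniform probability measure on the sample indices. -/
noncomputable def uniformFin (m : ℕ) : Measure (Fin m) := (m : ENNReal)⁻¹ • Measure.count

lemma isProbabilityMeasure_uniformFin {m : ℕ} (hm : 0 < m) :
    IsProbabilityMeasure (uniformFin m) := by
  refine ⟨?_⟩
  rw [uniformFin, Measure.smul_apply, Measure.count_univ, smul_eq_mul]
  simp only [ENat.card_eq_coe_fintype_card, Fintype.card_fin]
  exact ENNReal.inv_mul_cancel (by simpa using hm.ne') (by simp)

lemma integral_uniformFin (m : ℕ) (h : Fin m → ℝ) :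
    ∫ k, h k ∂(uniformFin m) = (1 / (m : ℝ)) * ∑ k, h k := by
  rw [uniformFin, integral_smul_measure, integral_count]
  simp

variable {d : ℕ}

/-- The concentration results need an integrand measurable and bounded everywhere, whereas `α` is
only a.e. strongly measurable. A measurable modification of `α / ρ`, set to `0` where it exceeds the
norm, represents the same `f`. -/
lemma IsRepresentedBy.exists_bounded_measurable {σ : ℝ} (hσ : 0 < σ)
    {f α : EuclideanSpace ℝ (Fin d) → ℂ}
    (h : IsRepresentedBy fourierFeature (gaussianDensity d σ) f α) :
    ∃ g : EuclideanSpace ℝ (Fin d) → ℂ, Measurable g ∧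
      (∀ ω, ‖g ω‖ ≤ rhoNorm (gaussianDensity d σ) α) ∧
      (∀ᵐ ω ∂(sphericalGaussian d σ), g ω = α ω / (gaussianDensity d σ ω : ℂ)) ∧
      ∀ x, f x = ∫ ω, g ω * fourierFeature x ω ∂(sphericalGaussian d σ) := by
  set M := rhoNorm (gaussianDensity d σ) α with hM
  have hdm : Measurable fun ω : EuclideanSpace ℝ (Fin d) => (gaussianDensity d σ ω : ℂ) :=
    Complex.measurable_ofReal.comp (continuous_gaussianDensity d σ).measurable
  have hae : AEMeasurable (fun ω => α ω / (gaussianDensity d σ ω : ℂ)) volume :=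
    h.aestronglyMeasurable.aemeasurable.div hdm.aemeasurable
  have hle : ∀ ω, ‖α ω / (gaussianDensity d σ ω : ℂ)‖ ≤ M := fun ω => le_ciSup h.bddAbove ω
  have hM0 : 0 ≤ M := (norm_nonneg _).trans (hle 0)
  set g₀ := hae.mk _ with hg₀
  have hg₀m : Measurable g₀ := hae.measurable_mk
  set g : EuclideanSpace ℝ (Fin d) → ℂ := fun ω => if ‖g₀ ω‖ ≤ M then g₀ ω else 0 with hg
  have hgae : ∀ᵐ ω ∂volume, g ω = α ω / (gaussianDensity d σ ω : ℂ) := by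
    filter_upwards [hae.ae_eq_mk] with ω hω
    have : g₀ ω = α ω / (gaussianDensity d σ ω : ℂ) := hω.symm
    simp only [hg, this, hle ω, if_true]
  refine ⟨g, ?_, ?_, ?_, ?_⟩
  · exact Measurable.ite (measurableSet_le hg₀m.norm measurable_const) hg₀m measurable_const
  · intro ω
    simp only [hg]
    split_ifs with h1
    · exact h1
    · simpa using hM0
  · exact (withDensity_absolutelyContinuous _ _).ae_le hgae
  · intro x
    rw [h.eq_integral, integral_sphericalGaussian hσ]
    refine integral_congr_ae ?_
    filter_upwards [hgae] with ω hω
    have : (gaussianDensity d σ ω : ℂ) ≠ 0 := by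
      exact_mod_cast (gaussianDensity_pos d hσ ω).ne'
    rw [hω]
    field_simp

lemma hasLaw_prod_of_iIndepFun {Ω E : Type*} [MeasurableSpace Ω] [MeasurableSpace E]
    {P : Measure Ω} [IsProbabilityMeasure P] {m N : ℕ} {x : Fin m → Ω → E} {w : Fin N → Ω → E}
    {μ ρ : Measure E} [IsProbabilityMeasure μ] [IsProbabilityMeasure ρ]
    (hx : ∀ k, HasLaw (x k) μ P) (hw : ∀ j, HasLaw (w j) ρ P)
    (hi : iIndepFun (Sum.elim x w) P) :
    HasLaw (fun τ => ((fun k => x k τ), (fun j => w j τ)))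
      ((Measure.pi fun _ : Fin m => μ).prod (Measure.pi fun _ : Fin N => ρ)) P := by
  set κ : Fin m ⊕ Fin N → Measure E := Sum.elim (fun _ => μ) (fun _ => ρ) with hκ
  have hprob : ∀ i, IsProbabilityMeasure (κ i) := by
    rintro (i | i) <;> simp only [hκ, Sum.elim_inl, Sum.elim_inr] <;> infer_instance
  have hlaw : ∀ i, HasLaw (Sum.elim x w i) (κ i) P := by
    rintro (i | i)
    · exact hx i
    · exact hw i
  have h1 := hi.hasLaw_pi hlaw
  exact (measurePreserving_sumPiEquivProdPi κ).comp_hasLaw h1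

end Events

/-! ### The good event -/

section GoodEvent

variable {d m N : ℕ}

local notation "𝔼" d => EuclideanSpace ℝ (Fin d)

/-- For fixed sample points this is concentration over the features, in `L²` of the uniform measure
on sample indices. -/
lemma measure_empiricalError_gt_le (hm : 0 < m) (hN : 0 < N) {μ ρ : Measure (𝔼 d)}
    [IsProbabilityMeasure μ] [IsProbabilityMeasure ρ] {g : (𝔼 d) → ℂ} (hg : Measurable g) {M : ℝ}
    (hM0 : 0 ≤ M) (hM : ∀ ω, ‖g ω‖ ≤ M) {a θ : ℝ} (ha : 0 ≤ a)
    (hθ : M / Real.sqrt N * (1 + Real.sqrt (2 * a)) ≤ θ) :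
    ((Measure.pi fun _ : Fin m => μ).prod (Measure.pi fun _ : Fin N => ρ))
      {p | θ < Real.sqrt ((1 / (m : ℝ)) * ∑ k, ‖(∫ ω, g ω * fourierFeature (p.1 k) ω ∂ρ) -
        (1 / (N : ℂ)) * ∑ j, g (p.2 j) * fourierFeature (p.1 k) (p.2 j)‖ ^ 2)} ≤
      ENNReal.ofReal (Real.exp (-a)) := by
  have hfeat : Measurable fun p : (𝔼 d) × (𝔼 d) => fourierFeature p.1 p.2 :=
    continuous_fourierFeature.measurable
  have hgf : Measurable fun p : (𝔼 d) × (𝔼 d) => g p.2 * fourierFeature p.1 p.2 :=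
    (hg.comp measurable_snd).mul hfeat
  have hmean : Measurable fun z : 𝔼 d => ∫ ω, g ω * fourierFeature z ω ∂ρ :=
    (StronglyMeasurable.integral_prod_right (ν := ρ)
      (f := fun z ω => g ω * fourierFeature z ω) hgf.stronglyMeasurable).measurable
  refine prod_le_of_forall_left _ _ ?_ fun x => ?_
  · refine measurableSet_lt measurable_const (Measurable.sqrt (Measurable.const_mul ?_ _))
    refine Finset.measurable_sum _ fun k _ => (Measurable.norm ?_).pow_const 2
    refine Measurable.sub ?_ (Measurable.const_mul (Finset.measurable_sum _ fun j _ => ?_) _)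
    · have : Measurable fun p : (Fin m → 𝔼 d) × (Fin N → 𝔼 d) => p.1 k := by fun_prop
      exact hmean.comp this
    · have : Measurable fun p : (Fin m → 𝔼 d) × (Fin N → 𝔼 d) => (p.1 k, p.2 j) := by fun_prop
      exact hgf.comp this
  · have := isProbabilityMeasure_uniformFin hm
    have hT : Measurable (Function.uncurry fun (ω : 𝔼 d) (k : Fin m) =>
        g ω * fourierFeature (x k) ω) := by
      refine measurable_from_prod_countable_left fun k => ?_
      have : Measurable fun ω : 𝔼 d => (x k, ω) := measurable_prodMk_left
      exact hgf.comp this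
    have h := measure_empiricalMean_gt_le ρ (uniformFin m) hN hT hM0
      (fun ω k => by rw [norm_mul, norm_fourierFeature, mul_one]; exact hM ω) ha hθ
    simp only [integral_uniformFin] at h
    exact h

lemma measure_populationError_gt_le (hN : 0 < N) {μ ρ : Measure (𝔼 d)}
    [IsProbabilityMeasure μ] [IsProbabilityMeasure ρ] {g : (𝔼 d) → ℂ} (hg : Measurable g) {M : ℝ}
    (hM0 : 0 ≤ M) (hM : ∀ ω, ‖g ω‖ ≤ M) {a θ : ℝ} (ha : 0 ≤ a)
    (hθ : M / Real.sqrt N * (1 + Real.sqrt (2 * a)) ≤ θ) :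
    (Measure.pi fun _ : Fin N => ρ)
      {w | θ < Real.sqrt (∫ z, ‖(∫ ω, g ω * fourierFeature z ω ∂ρ) -
        (1 / (N : ℂ)) * ∑ j, g (w j) * fourierFeature z (w j)‖ ^ 2 ∂μ)} ≤
      ENNReal.ofReal (Real.exp (-a)) := by
  have hT : Measurable (Function.uncurry fun (ω z : 𝔼 d) => g ω * fourierFeature z ω) :=
    (hg.comp measurable_fst).mul
      (continuous_fourierFeature.comp continuous_swap).measurable
  exact measure_empiricalMean_gt_le ρ μ hN hT hM0
    (fun ω k => by rw [norm_mul, norm_fourierFeature, mul_one]; exact hM ω) ha hθ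

/-- For fixed features the roles are exchanged: the samples are averaged, and `L²` over a one-point
space reduces the norm to a modulus. -/
lemma measure_charFun_deviation_gt_le (hm : 0 < m) {μ ρ : Measure (𝔼 d)}
    [IsProbabilityMeasure μ] [IsProbabilityMeasure ρ] (j l : Fin N) {a θ : ℝ} (ha : 0 ≤ a)
    (hθ : 1 / Real.sqrt m * (1 + Real.sqrt (2 * a)) ≤ θ) :
    ((Measure.pi fun _ : Fin m => μ).prod (Measure.pi fun _ : Fin N => ρ))
      {p | θ < ‖(∫ z, fourierFeature z (p.2 j - p.2 l) ∂μ) -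
        (1 / (m : ℂ)) * ∑ k, fourierFeature (p.1 k) (p.2 j - p.2 l)‖} ≤
      ENNReal.ofReal (Real.exp (-a)) := by
  have hfeat : Measurable fun p : (𝔼 d) × (𝔼 d) => fourierFeature p.1 p.2 :=
    continuous_fourierFeature.measurable
  have hmean : Measurable fun u : 𝔼 d => ∫ z, fourierFeature z u ∂μ :=
    (StronglyMeasurable.integral_prod_left (μ := μ)
      (f := fun z u => fourierFeature z u) hfeat.stronglyMeasurable).measurable
  refine prod_le_of_forall_right _ _ ?_ fun w => ?_
  · refine measurableSet_lt measurable_const (Measurable.norm ?_)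
    refine Measurable.sub ?_ (Measurable.const_mul (Finset.measurable_sum _ fun k _ => ?_) _)
    · have h1 : Measurable fun p : (Fin m → 𝔼 d) × (Fin N → 𝔼 d) => p.2 j := by fun_prop
      have h2 : Measurable fun p : (Fin m → 𝔼 d) × (Fin N → 𝔼 d) => p.2 l := by fun_prop
      exact hmean.comp (h1.sub h2)
    · have h0 : Measurable fun p : (Fin m → 𝔼 d) × (Fin N → 𝔼 d) => p.1 k := by fun_prop
      have h1 : Measurable fun p : (Fin m → 𝔼 d) × (Fin N → 𝔼 d) => p.2 j := by fun_prop
      have h2 : Measurable fun p : (Fin m → 𝔼 d) × (Fin N → 𝔼 d) => p.2 l := by fun_prop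
      have h3 := hfeat.comp (h0.prodMk (h1.sub h2))
      simpa only [Function.comp_def, Pi.sub_apply] using h3
  · have hT : Measurable (Function.uncurry fun (z : 𝔼 d) (_ : Unit) =>
        fourierFeature z (w j - w l)) :=
      (continuous_fourierFeature_left _).measurable.comp measurable_fst
    have h := measure_empiricalMean_gt_le μ (Measure.dirac ()) hm hT zero_le_one
      (fun z _ => (norm_fourierFeature z _).le) ha hθ
    simp only [integral_dirac, Real.sqrt_sq (norm_nonneg _)] at h
    exact h

lemma measure_noise_gt_le {Ω : Type*} [MeasurableSpace Ω] {P : Measure Ω} [IsProbabilityMeasure P]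
    {ν δ : ℝ} (hν : 0 ≤ ν) (hδ : Real.exp (-((m : ℝ) / 2)) ≤ δ) {e : Fin m → Ω → ℂ}
    (he : IsBoundedNoise P (2 * ν) e ∨ IsGaussianNoise P ν e) :
    P {τ | (m : ℝ) * (2 * ν) ^ 2 < ∑ k, ‖e k τ‖ ^ 2} ≤ ENNReal.ofReal δ := by
  have hbdd : IsBoundedNoise P (2 * ν) e →
      P {τ | (m : ℝ) * (2 * ν) ^ 2 < ∑ k, ‖e k τ‖ ^ 2} ≤ ENNReal.ofReal δ := by
    intro h
    have : P {τ | (m : ℝ) * (2 * ν) ^ 2 < ∑ k, ‖e k τ‖ ^ 2} = 0 := by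
      have h2 : ∀ᵐ τ ∂P, ¬ ((m : ℝ) * (2 * ν) ^ 2 < ∑ k, ‖e k τ‖ ^ 2) := by
        filter_upwards [h] with τ hτ
        rw [not_lt]
        calc ∑ k, ‖e k τ‖ ^ 2 ≤ ∑ _k : Fin m, (2 * ν) ^ 2 :=
              Finset.sum_le_sum fun k _ => pow_le_pow_left₀ (norm_nonneg _) (hτ k) 2
          _ = m * (2 * ν) ^ 2 := by simp
      simpa using ae_iff.1 h2
    rw [this]; exact zero_le
  rcases he with h | ⟨g, hge, hlaw, hi⟩
  · exact hbdd h
  · rcases hν.eq_or_lt with h0 | hpos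
    -- For `ν = 0` the Gaussian law is a point mass at `0`, so the noise vanishes almost surely.
    · refine hbdd ?_
      have hz : ∀ k, ∀ᵐ τ ∂P, g k τ = 0 := by
        intro k
        have := hlaw k
        rw [← h0] at this
        simp only [ne_eq, OfNat.ofNat_ne_zero, not_false_eq_true, zero_pow, Real.toNNReal_zero,
          gaussianReal_zero_var] at this
        exact this.ae_eq_of_dirac
      filter_upwards [ae_all_iff.2 hz] with τ hτ k
      simp [hge, hτ, hν]
    · have hv : Real.toNNReal (ν ^ 2) ≠ 0 := by
        rw [ne_eq, Real.toNNReal_eq_zero, not_le]; positivity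
      have h1 := measure_sum_sq_gaussian_ge_le hv hlaw hi
      rw [Real.coe_toNNReal _ (by positivity)] at h1
      rw [← ENNReal.ofReal_toReal (measure_ne_top P _)]
      refine ENNReal.ofReal_le_ofReal (le_trans ?_ (h1.trans hδ))
      refine measureReal_mono fun τ hτ => ?_
      simp only [Set.mem_ofPred_eq, hge, Complex.norm_real, Real.norm_eq_abs, sq_abs] at hτ ⊢
      linarith

lemma measure_preimage_le_of_hasLaw {Ω E : Type*} [MeasurableSpace Ω] [MeasurableSpace E]
    {P : Measure Ω} {Q : Measure E} {X : Ω → E} (hX : HasLaw X Q P) (A : Set E) :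
    P (X ⁻¹' A) ≤ Q A := by
  rw [← hX.map_eq]
  exact Measure.le_map_apply hX.aemeasurable A

lemma measure_exists_le {Ω ι : Type*} [MeasurableSpace Ω] [Fintype ι] {P : Measure Ω}
    {B : ι → Set Ω} {a r : ℝ} (h : ∀ i, P (B i) ≤ ENNReal.ofReal a)
    (hr : Fintype.card ι * a ≤ r) : P {τ | ∃ i, τ ∈ B i} ≤ ENNReal.ofReal r := by
  have : {τ | ∃ i, τ ∈ B i} = ⋃ i, B i := by ext τ; simp
  rw [this]
  refine (measure_iUnion_fintype_le P B).trans ((Finset.sum_le_sum fun i _ => h i).trans ?_)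
  rw [Finset.sum_const, Finset.card_univ, nsmul_eq_mul, ← ENNReal.ofReal_natCast,
    ← ENNReal.ofReal_mul (Nat.cast_nonneg _)]
  exact ENNReal.ofReal_le_ofReal hr

lemma exists_measurableSet_compl_of_le {Ω : Type*} [MeasurableSpace Ω] {P : Measure Ω}
    [IsProbabilityMeasure P] {B : Set Ω} {r : ℝ} (hr : 0 ≤ r) (hB : P B ≤ ENNReal.ofReal r) :
    ∃ G : Set Ω, MeasurableSet G ∧ P G ≥ ENNReal.ofReal (1 - r) ∧ ∀ τ ∈ G, τ ∉ B := by
  refine ⟨(toMeasurable P B)ᶜ, (measurableSet_toMeasurable _ _).compl, ?_,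
    fun τ hτ h => hτ (subset_toMeasurable P B h)⟩
  rw [prob_compl_eq_one_sub (measurableSet_toMeasurable _ _), measure_toMeasurable,
    ENNReal.ofReal_sub _ hr, ENNReal.ofReal_one]
  exact tsub_le_tsub_left hB 1

/-- With probability at least `1 - 5δ` all the random quantities are under control. -/
theorem exists_good_event (hm : 0 < m) (hN : 0 < N) {γ σ ν ε δ : ℝ} (hγ : 0 < γ) (hσ : 0 < σ)
    (hν : 0 ≤ ν) (hδ : 0 < δ) (hδ1 : δ < 1)
    (hδm : Real.exp (-((m : ℝ) / 2)) ≤ δ)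
    {f α : (𝔼 d) → ℂ} (hf : IsRepresentedBy fourierFeature (gaussianDensity d σ) f α)
    (hNε : rhoNorm (gaussianDensity d σ) α / Real.sqrt N * (1 + Real.sqrt (2 * Real.log (1 / δ))) ≤
      ε * rhoNorm (gaussianDensity d σ) α)
    {Ω : Type*} [MeasurableSpace Ω] {P : Measure Ω} [IsProbabilityMeasure P]
    {x : Fin m → Ω → 𝔼 d} {w : Fin N → Ω → 𝔼 d} {e : Fin m → Ω → ℂ}
    (hx : ∀ k, HasLaw (x k) (sphericalGaussian d γ) P)
    (hw : ∀ j, HasLaw (w j) (sphericalGaussian d σ) P)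
    (hi : iIndepFun (Sum.elim x w) P)
    (he : IsBoundedNoise P (2 * ν) e ∨ IsGaussianNoise P ν e) :
    ∃ G : Set Ω, MeasurableSet G ∧ P G ≥ ENNReal.ofReal (1 - 5 * δ) ∧ ∀ τ ∈ G,
      Real.sqrt ((1 / (m : ℝ)) * ∑ k, ‖f (x k τ) - prunedExpansion (fun j => w j τ)
        (cStar (gaussianDensity d σ) α fun j => w j τ) Finset.univ (x k τ)‖ ^ 2) ≤
        ε * rhoNorm (gaussianDensity d σ) α ∧
      l2Error (sphericalGaussian d γ) f (prunedExpansion (fun j => w j τ)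
        (cStar (gaussianDensity d σ) α fun j => w j τ) Finset.univ) ≤
        ε * rhoNorm (gaussianDensity d σ) α ∧
      (∀ j l, ‖(∫ z, fourierFeature z (w j τ - w l τ) ∂(sphericalGaussian d γ)) -
        (1 / (m : ℂ)) * ∑ k, fourierFeature (x k τ) (w j τ - w l τ)‖ ≤
        1 / Real.sqrt m * (1 + Real.sqrt (2 * Real.log ((N : ℝ) ^ 2 / δ)))) ∧
      (∀ j, ∑ l, Real.exp (-(γ ^ 2 * ‖w l τ - w j τ‖ ^ 2 / 2)) ≤
        1 + 2 * N * (1 + γ ^ 2 * σ ^ 2) ^ (-((d : ℝ) / 2)) + Real.log (N / δ)) ∧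
      ∑ k, ‖e k τ‖ ^ 2 ≤ m * (2 * ν) ^ 2 := by
  have hpμ := isProbabilityMeasure_sphericalGaussian d hγ
  have hpρ := isProbabilityMeasure_sphericalGaussian d hσ
  obtain ⟨g, hgm, hgM, hgα, hfg⟩ := hf.exists_bounded_measurable hσ
  set μ := sphericalGaussian d γ with hμ
  set ρ := sphericalGaussian d σ with hρ
  set M := rhoNorm (gaussianDensity d σ) α with hM
  have hM0 : 0 ≤ M := (norm_nonneg _).trans (hgM 0)
  have hN0 : (0 : ℝ) < N := by exact_mod_cast hN
  have hN1 : (1 : ℝ) ≤ N := by exact_mod_cast hN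
  have hlaw := hasLaw_prod_of_iIndepFun hx hw hi
  have hlawW : HasLaw (fun τ j => w j τ) (Measure.pi fun _ : Fin N => ρ) P :=
    measurePreserving_snd.comp_hasLaw hlaw
  have hL0 : 0 ≤ Real.log (1 / δ) := Real.log_nonneg (by rw [le_div_iff₀ hδ]; linarith)
  have hexpL : Real.exp (-Real.log (1 / δ)) = δ := by
    rw [one_div, Real.log_inv, neg_neg, Real.exp_log hδ]
  have hP1 : P {τ | ε * M < Real.sqrt ((1 / (m : ℝ)) * ∑ k,
      ‖(∫ ω, g ω * fourierFeature (x k τ) ω ∂ρ) -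
        (1 / (N : ℂ)) * ∑ j, g (w j τ) * fourierFeature (x k τ) (w j τ)‖ ^ 2)} ≤
      ENNReal.ofReal δ :=
    (measure_preimage_le_of_hasLaw hlaw _).trans
      ((measure_empiricalError_gt_le (μ := μ) (ρ := ρ) hm hN hgm hM0 hgM hL0 hNε).trans_eq
        (by rw [hexpL]))
  have hP2 : P {τ | ε * M < Real.sqrt (∫ z, ‖(∫ ω, g ω * fourierFeature z ω ∂ρ) -
        (1 / (N : ℂ)) * ∑ j, g (w j τ) * fourierFeature z (w j τ)‖ ^ 2 ∂μ)} ≤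
      ENNReal.ofReal δ :=
    (measure_preimage_le_of_hasLaw hlawW _).trans
      ((measure_populationError_gt_le (μ := μ) (ρ := ρ) hN hgm hM0 hgM hL0 hNε).trans_eq
        (by rw [hexpL]))
  have ha0 : 0 ≤ Real.log ((N : ℝ) ^ 2 / δ) := Real.log_nonneg (by
    rw [le_div_iff₀ hδ]; nlinarith)
  have hexpa : Real.exp (-Real.log ((N : ℝ) ^ 2 / δ)) = δ / N ^ 2 := by
    rw [← Real.log_inv, inv_div, Real.exp_log (by positivity)]
  -- A union over the `N²` index pairs, each failing with probability at most `δ / N²`.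
  have hP3 : P {τ | ∃ q : Fin N × Fin N,
      1 / Real.sqrt m * (1 + Real.sqrt (2 * Real.log ((N : ℝ) ^ 2 / δ))) <
      ‖(∫ z, fourierFeature z (w q.1 τ - w q.2 τ) ∂μ) -
        (1 / (m : ℂ)) * ∑ k, fourierFeature (x k τ) (w q.1 τ - w q.2 τ)‖} ≤ ENNReal.ofReal δ := by
    refine measure_exists_le (fun q => (measure_preimage_le_of_hasLaw hlaw _).trans
      ((measure_charFun_deviation_gt_le (μ := μ) (ρ := ρ) hm q.1 q.2 ha0 le_rfl).trans_eq
        (by rw [hexpa]))) ?_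
    rw [Fintype.card_prod, Fintype.card_fin]
    push_cast
    field_simp
    exact le_rfl
  have hkm : Measurable (Function.uncurry fun a b : 𝔼 d =>
      Real.exp (-(γ ^ 2 * ‖a - b‖ ^ 2 / 2))) := by
    have h1 : Measurable fun p : (𝔼 d) × (𝔼 d) => p.1 - p.2 := measurable_fst.sub measurable_snd
    exact (((h1.norm.pow_const 2).const_mul _).div_const _).neg.exp
  have hexpN : Real.exp (-Real.log (N / δ)) = δ / N := by
    rw [← Real.log_inv, inv_div, Real.exp_log (by positivity)]
  have hP4 : P {τ | ∃ j, 1 + 2 * N * (1 + γ ^ 2 * σ ^ 2) ^ (-((d : ℝ) / 2)) + Real.log (N / δ) ≤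
      ∑ l, Real.exp (-(γ ^ 2 * ‖w l τ - w j τ‖ ^ 2 / 2))} ≤ ENNReal.ofReal δ := by
    refine measure_exists_le (a := δ / N) (fun j =>
      (measure_preimage_le_of_hasLaw hlawW {w : Fin N → 𝔼 d |
        1 + 2 * N * (1 + γ ^ 2 * σ ^ 2) ^ (-((d : ℝ) / 2)) + Real.log (N / δ) ≤
        ∑ l, Real.exp (-(γ ^ 2 * ‖w l - w j‖ ^ 2 / 2))}).trans ?_) ?_
    · rw [← ENNReal.ofReal_toReal (measure_ne_top (Measure.pi fun _ : Fin N => ρ) _), ← hexpN]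
      exact ENNReal.ofReal_le_ofReal (measure_kernel_rowSum_ge_le ρ hkm
        (fun a b => (Real.exp_pos _).le) (fun a b => Real.exp_le_one_iff.2 (by
          have : 0 ≤ γ ^ 2 * ‖a - b‖ ^ 2 / 2 := by positivity
          linarith))
        (by positivity) (fun b => integral_exp_neg_dist_sq_le hσ b) j _)
    · rw [Fintype.card_fin]
      field_simp
      exact le_rfl
  have hP5 := measure_noise_gt_le hν hδm he
  -- Returning from `g` to `α / ρ` at the sampled frequencies costs only a null set, so the total
  -- stays at `5δ`.
  have hP6 : P {τ | ¬ ∀ j, g (w j τ) = α (w j τ) / (gaussianDensity d σ (w j τ) : ℂ)} = 0 := by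
    refine ae_iff.1 (ae_all_iff.2 fun j => ?_)
    have h1 := hgα
    rw [← (hw j).map_eq] at h1
    exact ae_of_ae_map (hw j).aemeasurable h1
  have hunion := (measure_union_le (μ := P) _ _).trans (add_le_add ((measure_union_le _ _).trans
    (add_le_add ((measure_union_le _ _).trans (add_le_add ((measure_union_le _ _).trans
    (add_le_add ((measure_union_le _ _).trans (add_le_add hP1 hP2)) hP3)) hP4)) hP5)) hP6.le)
  have hsum : ENNReal.ofReal δ + ENNReal.ofReal δ + ENNReal.ofReal δ + ENNReal.ofReal δ +
      ENNReal.ofReal δ + 0 = ENNReal.ofReal (5 * δ) := by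
    rw [add_zero, ← ENNReal.ofReal_add (by positivity) (by positivity),
      ← ENNReal.ofReal_add (by positivity) (by positivity),
      ← ENNReal.ofReal_add (by positivity) (by positivity),
      ← ENNReal.ofReal_add (by positivity) (by positivity)]
    congr 1; ring
  rw [hsum] at hunion
  obtain ⟨G, hGm, hGP, hG⟩ := exists_measurableSet_compl_of_le (by positivity) hunion
  refine ⟨G, hGm, hGP, fun τ hτ => ?_⟩
  have hτ' := hG τ hτ
  simp only [Set.mem_union, Set.mem_ofPred_eq, not_or, not_not, not_lt, not_le, not_exists] at hτ'
  obtain ⟨⟨⟨⟨⟨h1, h2⟩, h3⟩, h4⟩, h5⟩, h6⟩ := hτ'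
  have hexpand : ∀ z, prunedExpansion (fun j => w j τ)
      (cStar (gaussianDensity d σ) α fun j => w j τ) Finset.univ z =
      (1 / (N : ℂ)) * ∑ j, g (w j τ) * fourierFeature z (w j τ) := by
    intro z
    simp only [prunedExpansion, cStar, h6, Finset.mul_sum, mul_assoc]
  refine ⟨?_, ?_, fun j l => h3 (j, l), fun j => (h4 j).le, h5⟩
  · simpa only [hexpand, hfg] using h1
  · simpa only [l2Error, hexpand, hfg] using h2

end GoodEvent

/-! ### Collecting the estimates -/

section Assembly

lemma IsRepresentedBy.memLp {d : ℕ} {σ : ℝ} (hσ : 0 < σ) {f α : EuclideanSpace ℝ (Fin d) → ℂ}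
    (h : IsRepresentedBy fourierFeature (gaussianDensity d σ) f α)
    (μ : Measure (EuclideanSpace ℝ (Fin d))) [IsFiniteMeasure μ] : MemLp f 2 μ := by
  have hρ := isProbabilityMeasure_sphericalGaussian d hσ
  obtain ⟨g, hgm, hgM, -, hfg⟩ := h.exists_bounded_measurable hσ
  have hgf : Measurable fun p : EuclideanSpace ℝ (Fin d) × EuclideanSpace ℝ (Fin d) =>
      g p.2 * fourierFeature p.1 p.2 :=
    (hgm.comp measurable_snd).mul continuous_fourierFeature.measurable
  have hfm : Measurable f := by
    rw [funext hfg]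
    exact (StronglyMeasurable.integral_prod_right (ν := sphericalGaussian d σ)
      (f := fun z ω => g ω * fourierFeature z ω) hgf.stronglyMeasurable).measurable
  refine memLp_two_of_norm_le hfm (B := rhoNorm (gaussianDensity d σ) α) fun z => ?_
  rw [hfg]
  have := norm_integral_le_of_norm_le_const (μ := sphericalGaussian d σ)
    (f := fun ω => g ω * fourierFeature z ω) (C := rhoNorm (gaussianDensity d σ) α)
    (ae_of_all _ fun ω => by rw [norm_mul, norm_fourierFeature, mul_one]; exact hgM ω)
  simpa using this

lemma l2Norm_residual_le {d m N : ℕ} (hm : 0 < m) (x : Fin m → EuclideanSpace ℝ (Fin d))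
    (w : Fin N → EuclideanSpace ℝ (Fin d)) (c : Fin N → ℂ) (f : EuclideanSpace ℝ (Fin d) → ℂ)
    (e : Fin m → ℂ) {β r : ℝ} (hβ : Real.sqrt ((1 / (m : ℝ)) *
      ∑ k, ‖f (x k) - prunedExpansion w c Finset.univ (x k)‖ ^ 2) ≤ β)
    (he : ∑ k, ‖e k‖ ^ 2 ≤ m * r ^ 2) :
    l2Norm ((featureMatrix x w).mulVec c - fun k => f (x k) + e k) ≤
      Real.sqrt (2 * (β ^ 2 + r ^ 2)) * Real.sqrt m := by
  have hm0 : (0 : ℝ) < m := by exact_mod_cast hm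
  have h1 : ∑ k, ‖f (x k) - prunedExpansion w c Finset.univ (x k)‖ ^ 2 ≤ m * β ^ 2 := by
    have h2 := (Real.sqrt_le_left ((Real.sqrt_nonneg _).trans hβ)).1 hβ
    rwa [one_div, inv_mul_le_iff₀ hm0] at h2
  rw [← Real.sqrt_mul (by positivity), l2Norm]
  refine Real.sqrt_le_sqrt ?_
  have h3 : ∀ k, ‖((featureMatrix x w).mulVec c - fun k => f (x k) + e k) k‖ ^ 2 ≤
      2 * ‖f (x k) - prunedExpansion w c Finset.univ (x k)‖ ^ 2 + 2 * ‖e k‖ ^ 2 := by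
    intro k
    have h4 : ((featureMatrix x w).mulVec c - fun k => f (x k) + e k) k =
        -((f (x k) - prunedExpansion w c Finset.univ (x k)) + e k) := by
      simp [Matrix.mulVec, dotProduct, featureMatrix, prunedExpansion, mul_comm]
      ring
    rw [h4, norm_neg]
    have h5 := norm_add_le (f (x k) - prunedExpansion w c Finset.univ (x k)) (e k)
    have h6 := pow_le_pow_left₀ (norm_nonneg _) h5 2
    nlinarith [sq_nonneg (‖f (x k) - prunedExpansion w c Finset.univ (x k)‖ - ‖e k‖)]
  calc _ ≤ ∑ k, (2 * ‖f (x k) - prunedExpansion w c Finset.univ (x k)‖ ^ 2 + 2 * ‖e k‖ ^ 2) :=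
        Finset.sum_le_sum fun k _ => h3 k
    _ ≤ 2 * (β ^ 2 + r ^ 2) * m := by
        rw [Finset.sum_add_distrib, ← Finset.mul_sum, ← Finset.mul_sum]
        linarith

/-- Collecting the terms of the deterministic error bound. -/
lemma error_terms_le {s N : ℕ} (hs : 1 ≤ s) (hN : 0 < N) {ε ν M κ t K : ℝ} (hε : 0 < ε)
    (hM : 0 ≤ M) (hκ : 0 ≤ κ) (ht : 0 ≤ t) (hNε : 2 ≤ ε * Real.sqrt N)
    (hK : s < N → Real.sqrt (s * K) ≤ ε * N * (1 + t)) :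
    ε * M + (2 * Real.sqrt (2 * (ε ^ 2 * M ^ 2 + (2 * ν) ^ 2)) +
      2 * (κ + (min s N : ℕ) * (M / N)) * Real.sqrt (1 / (2 * s))) +
      (if s < N then κ + M / N * Real.sqrt (s * K) else 0) ≤
      3 * κ + (7 + t) * Real.sqrt (ε ^ 2 * M ^ 2 + 4 * ν ^ 2) := by
  have hN0 : (0 : ℝ) < N := by exact_mod_cast hN
  have hs1 : (1 : ℝ) ≤ s := by exact_mod_cast hs
  set E := Real.sqrt (ε ^ 2 * M ^ 2 + 4 * ν ^ 2) with hE
  have hE0 : 0 ≤ E := Real.sqrt_nonneg _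
  have hεM : ε * M ≤ E := Real.le_sqrt_of_sq_le (by nlinarith [sq_nonneg ν])
  have hη : Real.sqrt (2 * (ε ^ 2 * M ^ 2 + (2 * ν) ^ 2)) ≤ 3 / 2 * E := by
    rw [show (2 * ν) ^ 2 = 4 * ν ^ 2 by ring, Real.sqrt_mul (by norm_num)]
    gcongr
    rw [Real.sqrt_le_left (by norm_num)]; norm_num
  have hΔ1 : Real.sqrt (1 / (2 * s)) ≤ 1 := by
    refine Real.sqrt_le_one.2 ?_
    rw [div_le_one (by positivity)]; linarith
  -- The square of `min(s, N)` is at most `s N`. This lets the precision `1/(2s)` absorb the `s b`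
  -- part of the `ℓ¹` norm.
  have hmin : ((min s N : ℕ) : ℝ) * Real.sqrt (1 / (2 * s)) ≤ Real.sqrt N := by
    refine Real.le_sqrt_of_sq_le ?_
    rw [mul_pow, Real.sq_sqrt (by positivity)]
    have h1 : ((min s N : ℕ) : ℝ) ≤ s := by exact_mod_cast min_le_left s N
    have h2 : ((min s N : ℕ) : ℝ) ≤ N := by exact_mod_cast min_le_right s N
    have h3 : ((min s N : ℕ) : ℝ) ^ 2 ≤ s * N := by
      rw [sq]; exact mul_le_mul h1 h2 (Nat.cast_nonneg _) (by positivity)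
    rw [mul_one_div, div_le_iff₀ (by positivity)]
    nlinarith [mul_pos hN0 (by linarith : (0 : ℝ) < s)]
  have hMN : Real.sqrt N * (M / N) ≤ ε * M / 2 := by
    have h1 : Real.sqrt N * Real.sqrt N = N := Real.mul_self_sqrt hN0.le
    have h2 : 0 < Real.sqrt N := Real.sqrt_pos.2 hN0
    rw [← mul_div_assoc, div_le_iff₀ hN0]
    nlinarith [mul_le_mul_of_nonneg_left hNε (mul_nonneg hM h2.le)]
  have hfit : 2 * (κ + (min s N : ℕ) * (M / N)) * Real.sqrt (1 / (2 * s)) ≤ 2 * κ + ε * M := by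
    have h1 : κ * Real.sqrt (1 / (2 * s)) ≤ κ := mul_le_of_le_one_right hκ hΔ1
    have h2 : ((min s N : ℕ) : ℝ) * Real.sqrt (1 / (2 * s)) * (M / N) ≤ Real.sqrt N * (M / N) := by
      gcongr
    nlinarith
  have hprune : (if s < N then κ + M / N * Real.sqrt (s * K) else 0) ≤ κ + ε * M * (1 + t) := by
    split_ifs with h
    · have : M / N * Real.sqrt (s * K) ≤ M / N * (ε * N * (1 + t)) := by
        gcongr; exact hK h
      have e1 : M / N * (ε * N * (1 + t)) = ε * M * (1 + t) := by field_simp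
      linarith
    · positivity
  have ht' : ε * M * (1 + t) ≤ E * (1 + t) := by gcongr
  linarith

end Assembly

end SRFE

theorem theorem1 :
    ∃ C' : ℝ, 0 < C' ∧ ∀ d : ℕ, 0 < d → ∃ C : ℝ, 0 < C ∧
      ∀ (γ σ ν ε δ : ℝ) (s m N : ℕ),
        0 < γ → 0 < σ → 0 ≤ ν → 0 < ε → 0 < δ → δ < 1 → 1 ≤ s →
        γ ^ 2 * σ ^ 2 ≥
          1 / 2 * ((Real.sqrt 41 * (2 * (s : ℝ) - 1) / 2) ^ ((2 : ℝ) / (d : ℝ)) - 1) →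
        (N : ℝ) = 4 / ε ^ 2 *
          (1 + 4 * γ * σ * d *
              Real.sqrt (1 + Real.sqrt (12 / (d : ℝ) * Real.log ((m : ℝ) / δ)))
            + Real.sqrt (1 / 2 * Real.log (1 / δ))) ^ 2 →
        (m : ℝ) ≥ 4 * (2 * γ ^ 2 * σ ^ 2 + 1) ^ d * Real.log ((N : ℝ) ^ 2 / δ) →
      ∀ (f α : EuclideanSpace ℝ (Fin d) → ℂ),
        SRFE.IsRepresentedBy SRFE.fourierFeature (SRFE.gaussianDensity d σ) f α →
      ∀ {Ω : Type*} [MeasurableSpace Ω] (P : Measure Ω) [IsProbabilityMeasure P]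
        (x : Fin m → Ω → EuclideanSpace ℝ (Fin d)) (w : Fin N → Ω → EuclideanSpace ℝ (Fin d))
        (e : Fin m → Ω → ℂ),
        (∀ k, HasLaw (x k) (SRFE.sphericalGaussian d γ) P) →
        (∀ j, HasLaw (w j) (SRFE.sphericalGaussian d σ) P) →
        iIndepFun (Sum.elim x w) P →
        (SRFE.IsBoundedNoise P (2 * ν) e ∨ SRFE.IsGaussianNoise P ν e) →
      ∃ G : Set Ω, MeasurableSet G ∧ P G ≥ ENNReal.ofReal (1 - 5 * δ) ∧ ∀ τ ∈ G,
        let A : Matrix (Fin m) (Fin N) ℂ :=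
          SRFE.featureMatrix (fun k => x k τ) (fun j => w j τ)
        let y : Fin m → ℂ := fun k => f (x k τ) + e k τ
        let fNorm : ℝ := SRFE.rhoNorm (SRFE.gaussianDensity d σ) α
        let η : ℝ := Real.sqrt (2 * (ε ^ 2 * fNorm ^ 2 + (2 * ν) ^ 2))
        (∃ c : Fin N → ℂ, SRFE.IsBasisPursuitSolution A y η c) ∧
        ∀ (c : Fin N → ℂ) (S : Finset (Fin N)),
          SRFE.IsBasisPursuitSolution A y η c → SRFE.IsLargestIndexSet s c S →
          SRFE.l2Error (SRFE.sphericalGaussian d γ) f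
              (SRFE.prunedExpansion (fun j => w j τ) c S) ≤
            C' * (1 + (N : ℝ) ^ (1 / 2 : ℝ) * (s : ℝ) ^ (-(1 / 2) : ℝ) *
                (m : ℝ) ^ (-(1 / 4) : ℝ) * Real.log (1 / δ) ^ (1 / 4 : ℝ)) *
              SRFE.kappaOne s
                (SRFE.cStar (SRFE.gaussianDensity d σ) α (fun j => w j τ)) +
            C * (1 + (N : ℝ) ^ (1 / 2 : ℝ) * (m : ℝ) ^ (-(1 / 4) : ℝ) *
                Real.log (1 / δ) ^ (1 / 4 : ℝ)) *
              Real.sqrt (ε ^ 2 * fNorm ^ 2 + 4 * ν ^ 2) := by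
  -- The fit contributes `2κ` and pruning `κ`. The dimension enters `C` only through the Gram row
  -- sums.
  refine ⟨3, by norm_num, fun d hd => ⟨7 + 2 ^ ((d : ℝ) / 2), by positivity, ?_⟩⟩
  intro γ σ ν ε δ s m N hγ hσ hν hε hδ hδ1 hs hR hN hm f α hf Ω _ P _ x w e hx hw hi he
  -- For `δ ≥ 1/5` the required probability is not positive and the empty event suffices. Otherwise
  -- `N² / δ > 5 > e`, which gives `1 ≤ a` below.
  rcases le_or_gt (1 / 5) δ with hδ5 | hδ5
  · refine ⟨∅, MeasurableSet.empty, ?_, by simp⟩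
    rw [ENNReal.ofReal_of_nonpos (by linarith)]
    exact zero_le
  have hN0 : 0 < N := by
    have : (0 : ℝ) < N := by
      rw [hN]
      positivity
    exact_mod_cast this
  have hN1 : (1 : ℝ) ≤ N := by exact_mod_cast hN0
  have hL0 : 0 ≤ Real.log (1 / δ) := Real.log_nonneg (by rw [le_div_iff₀ hδ]; linarith)
  set a := Real.log ((N : ℝ) ^ 2 / δ) with ha
  have ha1 : 1 ≤ a := by
    rw [ha, Real.le_log_iff_exp_le (by positivity), le_div_iff₀ hδ]
    have := Real.exp_one_lt_d9
    nlinarith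
  have haL : Real.log (1 / δ) ≤ a := by
    refine Real.log_le_log (by positivity) ?_
    gcongr
    nlinarith
  set q : ℝ := (2 * (γ ^ 2 * σ ^ 2) + 1) ^ ((d : ℝ) / 2) with hq
  have hsq : 3 * (s : ℝ) ≤ q := SRFE.three_mul_le_of_bandwidth hd hs hR
  have hs1 : (1 : ℝ) ≤ s := by exact_mod_cast hs
  have hmq : 4 * q ^ 2 * a ≤ m := by
    have h1 : q ^ 2 = (2 * γ ^ 2 * σ ^ 2 + 1) ^ d := by
      rw [hq, ← Real.rpow_mul_natCast (by positivity), mul_assoc 2 (γ ^ 2) (σ ^ 2),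
        ← Real.rpow_natCast _ d]
      congr 1
      push_cast; ring
    rw [h1]; exact hm
  have hma : 36 * a ≤ m := by
    have : 9 ≤ q ^ 2 := by nlinarith
    nlinarith
  have hm0 : 0 < m := by
    have : (0 : ℝ) < m := by linarith
    exact_mod_cast this
  -- The sample condition gives `m ≥ 36 a ≥ 2 log(1/δ)`, enough for the Gaussian noise tail.
  have hδm : Real.exp (-((m : ℝ) / 2)) ≤ δ := by
    rw [← Real.le_log_iff_exp_le hδ]
    rw [one_div, Real.log_inv] at haL
    linarith
  obtain ⟨hNε, hNε2⟩ := SRFE.le_sample_size hε (by positivity) hN hL0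
  set M := SRFE.rhoNorm (SRFE.gaussianDensity d σ) α with hM
  have hM0 : 0 ≤ M := Real.iSup_nonneg fun _ => norm_nonneg _
  have hsN : (0 : ℝ) < Real.sqrt N := Real.sqrt_pos.2 (by linarith)
  have hMε : M / Real.sqrt N * (1 + Real.sqrt (2 * Real.log (1 / δ))) ≤ ε * M := by
    rw [div_mul_eq_mul_div, div_le_iff₀ hsN]
    nlinarith [mul_le_mul_of_nonneg_left hNε hM0]
  obtain ⟨G, hGm, hGP, hG⟩ :=
    SRFE.exists_good_event hm0 hN0 hγ hσ hν hδ hδ1 hδm hf hMε hx hw hi he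
  refine ⟨G, hGm, hGP, fun τ hτ => ?_⟩
  obtain ⟨h1, h2, h3, h4, h5⟩ := hG τ hτ
  intro A y fNorm η
  have hfeas : SRFE.l2Norm (A.mulVec (SRFE.cStar (SRFE.gaussianDensity d σ) α fun j => w j τ) - y) ≤
      η * Real.sqrt m := by
    have := SRFE.l2Norm_residual_le hm0 _ _ _ f (fun k => e k τ) h1 h5
    rwa [mul_pow] at this
  refine ⟨SRFE.exists_isBasisPursuitSolution A y hfeas, fun c S hc hS => ?_⟩
  have hprob := SRFE.isProbabilityMeasure_sphericalGaussian d hγ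
  have hlogN : 0 ≤ Real.log (N / δ) := Real.log_nonneg (by rw [le_div_iff₀ hδ]; linarith)
  have hmain := SRFE.l2Error_prunedExpansion_le hm0 hγ (hf.memLp hσ _) (fun k => x k τ)
    (fun j => w j τ) hs (Real.sqrt_nonneg _) (by positivity) (by positivity) (by positivity)
    (SRFE.norm_cStar_le hf.bddAbove _) h2 hfeas
    (fun j l => (h3 j l).trans (SRFE.deviation_le hs hsq ha1 hmq)) h4 hc hS
  refine hmain.trans ((SRFE.error_terms_le hs hN0 hε hM0 (SRFE.kappaOne_nonneg _ _)
    (by positivity : (0 : ℝ) ≤ 2 ^ ((d : ℝ) / 2)) (by linarith [Real.sqrt_nonneg (2 * Real.log (1 / δ))])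
    fun h => SRFE.sqrt_rowSum_le hs h (by positivity) hε hδ hδ1 hsq hNε2).trans ?_)
  refine add_le_add ?_ ?_
  · refine mul_le_mul_of_nonneg_right (le_mul_of_one_le_right (by norm_num) ?_)
      (SRFE.kappaOne_nonneg _ _)
    exact le_add_of_nonneg_right (by positivity)
  · refine mul_le_mul_of_nonneg_right (le_mul_of_one_le_right (by positivity) ?_)
      (Real.sqrt_nonneg _)
    exact le_add_of_nonneg_right (by positivity)
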